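/- \textbf{Setting.} A contextual decision process (CDP) with context space $\mathcal X$, action set $\mathcal A$, $|\mathcal A|=K<\infty$, and horizon $H\ge 1$ is given by a law for the first context $x_1$ and, for each $h$, a law for $(r_h,x_{h+1})$ given $x_1,a_1,r_1,\dots,x_h,a_h$. However actions are chosen, $r_h\ge 0$ and $\sum_{h=1}^H r_h\le 1$ almost surely. $V^\pi$ is the expected total reward when $a_h=\pi(x_h)$ for all $h$. Let $\mathcal F$ be a class of $N$ functions $f:\mathcal X\times\mathcal A\to[0,1]$, with the convention $f(x_{H+1},\cdot)=0$, and let $\pi_f(x)\in\arg\max_a f(x,a)$, ties being broken in a fixed way. The average Bellman error is $$\mathcal E(f,\pi,h)=\mathbb E\big[f(x_h,a_h)-r_h-f(x_{h+1},a_{h+1})\,\big|\,a_{1:h-1}\sim\pi,\ a_{h:h+1}\sim\pi_f\big].$$ Call $f\in\mathcal F$ valid if $\mathcal E(f,\pi_{f'},h)=0$ for all $f'\in\mathcal F$, $h\in[H]$. Suppose that $\mathcal F$ contains a valid function, and let $V^\star=\max\{V^{\pi_f}: f\in\mathcal F\text{ valid}\}$. The CDP and $\mathcal F$ admit a Bellman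 factorization with Bellman rank $M\ge 1$ and norm parameter $\zeta$ if there are $\nu_h,\xi_h:\mathcal F\to\mathbb R^M$ with $\mathcal E(f,\pi_{f'},h)=\langle\nu_h(f'),\xi_h(f)\rangle$ and $\|\nu_h(f')\|_2\|\xi_h(f)\|_2\le\zeta$ for all $f,f'\in\mathcal F$, $h\in[H]$. \textbf{OLIVE}$(\mathcal F,M,\zeta,\epsilon,\delta)$. Put $L=\log(6H\sqrt M\zeta/\epsilon)$, $\phi=\frac{\epsilon}{12H\sqrt M}$, $n_{\rm est}=\lceil\frac{32}{\epsilon^2}\log\frac{6N}{\delta}\rceil$, $n_{\rm eval}=\lceil\frac{288H^2}{\epsilon^2}\log\frac{12H^2ML}{\delta}\rceil$, $n=\lceil\frac{4608H^2MK}{\epsilon^2}\log\frac{12NHML}{\delta}\rceil$. Collect $n_{\rm est}$ episodes with arbitrary actions, let $\hat V_f$ be the average of $f(x_1,\pi_f(x_1))$ over them, and let $\mathcal F_0=\mathcal F$. For $t=1,2,\dots$: take any $f_t\in\arg\max_{f\in\mathcal F_{t-1}}\hat V_f$ and let $\pi_t=\pi_{f_t}$; collect $n_{\rm eval}$ episodes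 with $\pi_t$, and let $\tilde{\mathcal E}_h$ be the average of $f_t(x_h,a_h)-r_h-f_t(x_{h+1},a_{h+1})$; if $\sum_h\tilde{\mathcal E}_h\le 5\epsilon/8$, return $\pi_t$; otherwise pick any $h_t$ with $\tilde{\mathcal E}_{h_t}\ge 5\epsilon/(8H)$, collect $n$ episodes with $\pi_t$ except that $a_{h_t}$ is uniformly random, and let $\mathcal F_t$ be the set of those $f\in\mathcal F_{t-1}$ for which the average of $K\,\mathbf 1[a_{h_t}=\pi_f(x_{h_t})]\,\big(f(x_{h_t},a_{h_t})-r_{h_t}-f(x_{h_t+1},\pi_f(x_{h_t+1}))\big)$ is at most $\phi$ in absolute value. \textbf{GuessM}$(\mathcal F,\zeta,\epsilon,\delta)$, which is not given $M$: for $i=1,2,\dots$, let $M'=2^i$ and call OLIVE$(\mathcal F,M',\zeta,\epsilon,\frac{\delta}{i(i+1)})$, stopping the call as soon as $t>HM'\log(6H\sqrt{M'}\zeta/\epsilon)/\log(5/3)$; if the call returns a policy, return it and stop. \textbf{Theorem.} There are universal constants $C$ and $p$ such that the following holds for all $\epsilon,\delta\in(0,1)$ and for every CDP and every class $\mathcal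 F$ of $N$ functions, as above, that admit a Bellman factorization with parameters $M,\zeta$, where $\zeta\ge\epsilon/H$. However the choices left open above are made, with probability at least $1-\delta$ GuessM$(\mathcal F,\zeta,\epsilon,\delta)$ halts, returns a policy $\hat\pi$ with $V^{\hat\pi}\ge V^\star-\epsilon$, and uses at most $\tilde O\big(\frac{M^2H^3K}{\epsilon^2}\log\frac{N\zeta}{\delta}\big)$ episodes in total, that is, at most $$C\,\frac{M^2H^3K}{\epsilon^2}\,\max\Big\{1,\log\frac{N\zeta}{\delta}\Big\}\Big(1+\log\frac{MHK\max\{1,\zeta\}}{\epsilon}\Big)^p .$$ -/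

import Mathlib

open MeasureTheory ProbabilityTheory

noncomputable section

namespace CDP

/-- Measurable (deterministic, reactive) policies `X → A`. -/
abbrev Policy (X A : Type*) [MeasurableSpace X] [MeasurableSpace A] : Type _ :=
  {π : X → A // Measurable π}

/-- What an agent has seen when it has to choose its next action: the `h` completed steps
`(x, a, r)` and the current context. -/
abbrev Hist (X A : Type*) (h : ℕ) : Type _ := (Fin h → X × A × ℝ) × X

/-- A full episode `x₁, a₁, r₁, …, x_H, a_H, r_H, x_{H+1}`. -/
abbrev Traj (X A : Type*) (H : ℕ) : Type _ := Hist X A H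

/-- The system descriptor `P = (P_∅, P_+)` of a contextual decision process with contexts `X` and
actions `A`: the law of the first context, and the conditional law of the next reward and context
given the whole interaction so far. -/
structure System (X A : Type*) [MeasurableSpace X] [MeasurableSpace A] where
  init : Measure X
  init_prob : IsProbabilityMeasure init
  step : (h : ℕ) → Kernel (Hist X A h × A) (ℝ × X)
  step_markov : ∀ h, IsMarkovKernel (step h)

attribute [instance] System.init_prob System.step_markov

/-- An arbitrary (randomized, history dependent) way of choosing actions during an episode. -/
structure Rule (X A : Type*) [MeasurableSpace X] [MeasurableSpace A] where
  act : (h : ℕ) → Kernel (Hist X A h) A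
  act_markov : ∀ h, IsMarkovKernel (act h)

attribute [instance] Rule.act_markov

section Model

variable {X A : Type*} [MeasurableSpace X] [MeasurableSpace A]

/-- The kernel that plays `π` on the current context. -/
def playKernel (π : Policy X A) (h : ℕ) : Kernel (Hist X A h) A :=
  Kernel.deterministic (fun s => π.1 s.2) (π.2.comp measurable_snd)

/-- Play the policy `π k` at (zero-based) level `k`. -/
def Rule.ofPolicies (π : ℕ → Policy X A) : Rule X A where
  act k := playKernel (π k) k
  act_markov k := by unfold playKernel; infer_instance

/-- Play the policy `π` throughout. -/
def Rule.follow (π : Policy X A) : Rule X A := Rule.ofPolicies fun _ => π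

/-- Play `π` before level `h`, and `π'` from level `h` on. -/
def Rule.switch (π π' : Policy X A) (h : ℕ) : Rule X A :=
  Rule.ofPolicies fun k => if k < h then π else π'

/-- Play `π` at all levels except `h`, where the action is uniformly random. -/
def Rule.explore [Fintype A] [Nonempty A] (π : Policy X A) (h : ℕ) : Rule X A where
  act k := if k = h then Kernel.const _ (PMF.uniformOfFintype A).toMeasure else playKernel π k
  act_markov k := by
    split_ifs
    · infer_instance
    · unfold playKernel; infer_instance

/-- The law of the first `h` steps, and of the context that follows, when actions are chosen
by `β`. -/
def System.rollout (P : System X A) (β : Rule X A) : (h : ℕ) → Measure (Hist X A h)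
  | 0 => P.init.map fun x => (Fin.elim0, x)
  | h + 1 => ((P.rollout β h ⊗ₘ β.act h) ⊗ₘ P.step h).map fun z =>
      (Fin.snoc (α := fun _ => X × A × ℝ) z.1.1.1 (z.1.1.2, z.1.2, z.2.1), z.2.2)

/-- The context at (zero-based) level `h` of an episode. -/
def ctx {H : ℕ} (τ : Traj X A H) (h : Fin H) : X := (τ.1 h).1

/-- The action at level `h` of an episode. -/
def action {H : ℕ} (τ : Traj X A H) (h : Fin H) : A := (τ.1 h).2.1

/-- The reward at level `h` of an episode. -/
def reward {H : ℕ} (τ : Traj X A H) (h : Fin H) : ℝ := (τ.1 h).2.2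

/-- Regardless of how actions are chosen, the rewards of an episode are nonnegative and sum to at
most one, almost surely. -/
def System.RewardsBounded (P : System X A) (H : ℕ) : Prop :=
  ∀ β : Rule X A, ∀ᵐ τ ∂(P.rollout β H), (∀ h, 0 ≤ reward τ h) ∧ ∑ h, reward τ h ≤ 1

/-- The value `V^π`. -/
def System.value (P : System X A) (H : ℕ) (π : Policy X A) : ℝ :=
  ∫ τ, ∑ h, reward τ h ∂(P.rollout (Rule.follow π) H)

end Model

/-- A class of `N` functions `X × A → [0,1]`, each with its greedy policy `π_f` (ties broken in an
arbitrary, but fixed and measurable, way). -/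
structure QClass (X A : Type*) [MeasurableSpace X] [MeasurableSpace A] (N : ℕ) where
  val : Fin N → X → A → ℝ
  measurable_val : ∀ f a, Measurable fun x => val f x a
  val_mem : ∀ f x a, val f x a ∈ Set.Icc (0 : ℝ) 1
  greedy : Fin N → Policy X A
  val_le_greedy : ∀ f x a, val f x a ≤ val f x ((greedy f).1 x)

section Bellman

variable {X A : Type*} [MeasurableSpace X] [MeasurableSpace A] {N : ℕ}

/-- `f(x_{h+1}, a_{h+1})` with the action that was taken; it is `0` beyond the last level. -/
def QClass.nextTaken (F : QClass X A N) {H : ℕ} (f : Fin N) (τ : Traj X A H) (h : Fin H) : ℝ :=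
  if hh : h.1 + 1 < H then F.val f (ctx τ ⟨h.1 + 1, hh⟩) (action τ ⟨h.1 + 1, hh⟩) else 0

/-- `f(x_{h+1}, π_f(x_{h+1}))`; it is `0` beyond the last level. -/
def QClass.nextGreedy (F : QClass X A N) {H : ℕ} (f : Fin N) (τ : Traj X A H) (h : Fin H) : ℝ :=
  if hh : h.1 + 1 < H then
    F.val f (ctx τ ⟨h.1 + 1, hh⟩) ((F.greedy f).1 (ctx τ ⟨h.1 + 1, hh⟩)) else 0

/-- The average Bellman error of `f` under the roll-in policy `π` at level `h`. -/
def QClass.bellmanError (F : QClass X A N) (P : System X A) {H : ℕ}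
    (f : Fin N) (π : Policy X A) (h : Fin H) : ℝ :=
  ∫ τ, (F.val f (ctx τ h) (action τ h) - reward τ h - F.nextTaken f τ h)
    ∂(P.rollout (Rule.switch π (F.greedy f) h) H)

/-- `f` satisfies the Bellman equations for all roll-ins by greedy policies of the class. -/
def QClass.IsValid (F : QClass X A N) (P : System X A) (H : ℕ) (f : Fin N) : Prop :=
  ∀ (f' : Fin N) (h : Fin H), F.bellmanError P f (F.greedy f') h = 0

/-- `V⋆`, the largest value of the greedy policy of a valid function. -/
def QClass.optValue (F : QClass X A N) (P : System X A) (H : ℕ) : ℝ :=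
  sSup {v | ∃ f, F.IsValid P H f ∧ v = P.value H (F.greedy f)}

/-- Bellman factorization with Bellman rank `M` and norm parameter `ζ`. -/
def QClass.BellmanFactorization (F : QClass X A N) (P : System X A) (H M : ℕ) (ζ : ℝ) : Prop :=
  ∃ ν ξ : Fin H → Fin N → EuclideanSpace ℝ (Fin M), ∀ (f f' : Fin N) (h : Fin H),
    F.bellmanError P f (F.greedy f') h = inner ℝ (ν h f') (ξ h f) ∧ ‖ν h f'‖ * ‖ξ h f‖ ≤ ζ

end Bellman

/-! ### Parameters of OLIVE -/

/-- The elimination threshold. -/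
def phi (H M : ℕ) (ε : ℝ) : ℝ := ε / (12 * H * √M)

/-- `log (6 H √M ζ / ε)`. -/
def iterLog (H M : ℕ) (ζ ε : ℝ) : ℝ := Real.log (6 * H * √M * ζ / ε)

def nEst (N : ℕ) (ε δ : ℝ) : ℕ := ⌈32 / ε ^ 2 * Real.log (6 * N / δ)⌉₊

def nEval (H M : ℕ) (ζ ε δ : ℝ) : ℕ :=
  ⌈288 * H ^ 2 / ε ^ 2 * Real.log (12 * H ^ 2 * M * iterLog H M ζ ε / δ)⌉₊

def nLearn (K N H M : ℕ) (ζ ε δ : ℝ) : ℕ :=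
  ⌈4608 * H ^ 2 * M * K / ε ^ 2 * Real.log (12 * N * H * M * iterLog H M ζ ε / δ)⌉₊

/-- The iterations that are allowed are those with `t ≤ H M log (6 H √M ζ / ε) / log (5/3)`. -/
def maxIter (H M : ℕ) (ζ ε : ℝ) : ℕ := ⌊H * M * iterLog H M ζ ε / Real.log (5 / 3)⌋₊

/-- Everything that the pseudocode leaves open: how actions are chosen while the initial contexts
are collected (in each call, for each episode), which maximizer is taken, and which level with a
large estimate is picked. The choices may depend, through a memory of arbitrary type, on all the
data seen so far, in earlier calls too. -/
structure Resolver (X A : Type*) [MeasurableSpace X] [MeasurableSpace A] (H N : ℕ) (ε : ℝ)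
    (Mem : Type*) [MeasurableSpace Mem] where
  initRule : ℕ → ℕ → Rule X A
  observe : (n : ℕ) → Mem → (Fin n → Traj X A H) → Mem
  measurable_observe : ∀ n, Measurable fun z : Mem × (Fin n → Traj X A H) => observe n z.1 z.2
  pickFun : Mem → Finset (Fin N) → (Fin N → ℝ) → Fin N
  measurable_pickFun : ∀ S, Measurable fun z : Mem × (Fin N → ℝ) => pickFun z.1 S z.2
  pickFun_mem : ∀ (m : Mem) (S : Finset (Fin N)) (v : Fin N → ℝ), S.Nonempty → pickFun m S v ∈ S
  pickFun_max : ∀ (m : Mem) (S : Finset (Fin N)) (v : Fin N → ℝ), ∀ g ∈ S, v g ≤ v (pickFun m S v)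
  pickLevel : Mem → (Fin H → ℝ) → Fin H
  measurable_pickLevel : Measurable fun z : Mem × (Fin H → ℝ) => pickLevel z.1 z.2
  pickLevel_large : ∀ (m : Mem) (d : Fin H → ℝ), 5 * ε / 8 < ∑ h, d h →
    5 * ε / (8 * H) ≤ d (pickLevel m d)

section Algorithm

variable {X A : Type*} [MeasurableSpace X] [MeasurableSpace A] {N H : ℕ}

/-- The predicted value of `f`, estimated from the initial contexts of the episodes `D`. -/
def QClass.empValue (F : QClass X A N) (hH : 0 < H) {n : ℕ} (D : Fin n → Traj X A H)
    (f : Fin N) : ℝ :=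
  (∑ j, F.val f (ctx (D j) ⟨0, hH⟩) ((F.greedy f).1 (ctx (D j) ⟨0, hH⟩))) / n

/-- The estimate of the Bellman error of `f` on its own roll-in. -/
def QClass.evalError (F : QClass X A N) {n : ℕ} (D : Fin n → Traj X A H) (f : Fin N)
    (h : Fin H) : ℝ :=
  (∑ j, (F.val f (ctx (D j) h) (action (D j) h) - reward (D j) h - F.nextTaken f (D j) h)) / n

open Classical in
/-- The importance weighted estimate of the Bellman error of `f` from exploration data. -/
def QClass.learnError [Fintype A] (F : QClass X A N) {n : ℕ} (D : Fin n → Traj X A H)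
    (f : Fin N) (h : Fin H) : ℝ :=
  (∑ j, (if action (D j) h = (F.greedy f).1 (ctx (D j) h) then (Fintype.card A : ℝ) else 0) *
    (F.val f (ctx (D j) h) (action (D j) h) - reward (D j) h - F.nextGreedy f (D j) h)) / n

/-- The result of a computation that may fail: either the function whose greedy policy is returned,
or the memory at the time of the failure; in both cases with the number of episodes used. -/
abbrev Outcome (N : ℕ) (Mem : Type*) : Type _ := (Fin N × ℕ) ⊕ (Mem × ℕ)

variable [Fintype A] [Nonempty A] {ε : ℝ} {Mem : Type*} [MeasurableSpace Mem]

open Classical in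
/-- The for-loop of OLIVE, as the law of its outcome, with `t` more iterations allowed, surviving
functions `S`, value estimates `v`, current memory `m`, and `e` episodes used so far. -/
def oliveLoop (P : System X A) (F : QClass X A N) (R : Resolver X A H N ε Mem)
    (neval nlearn : ℕ) (φ : ℝ) (v : Fin N → ℝ) :
    ℕ → Finset (Fin N) → Mem → ℕ → Measure (Outcome N Mem)
  | 0, _, m, e => Measure.dirac (Sum.inr (m, e))
  | t + 1, S, m, e =>
    if S = ∅ then Measure.dirac (Sum.inr (m, e)) else
    let f := R.pickFun m S v
    (Measure.pi fun _ : Fin neval => P.rollout (Rule.follow (F.greedy f)) H).bind fun D =>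
      if ∑ h, F.evalError D f h ≤ 5 * ε / 8 then Measure.dirac (Sum.inl (f, e + neval)) else
      let m₁ := R.observe neval m D
      let h := R.pickLevel m₁ (F.evalError D f)
      (Measure.pi fun _ : Fin nlearn => P.rollout (Rule.explore (F.greedy f) h) H).bind fun E =>
        oliveLoop P F R neval nlearn φ v t (S.filter fun g => |F.learnError E g h| ≤ φ)
          (R.observe nlearn m₁ E) (e + neval + nlearn)

/-- The law of the outcome of the `i`-th call of GuessM: OLIVE with the parameters for Bellman rank
`2 ^ i` and failure probability `δ / (i (i + 1))`, stopped after `maxIter` iterations. -/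
def oliveCall (P : System X A) (F : QClass X A N) (hH : 0 < H) (R : Resolver X A H N ε Mem)
    (ζ δ : ℝ) (i : ℕ) (m : Mem) : Measure (Outcome N Mem) :=
  let M := 2 ^ i
  let δ' := δ / (i * (i + 1))
  let n₀ := nEst N ε δ'
  (Measure.pi fun j : Fin n₀ => P.rollout (R.initRule i j) H).bind fun D =>
    oliveLoop P F R (nEval H M ζ ε δ') (nLearn (Fintype.card A) N H M ζ ε δ') (phi H M ε)
      (F.empValue hH D) (maxIter H M ζ ε) Finset.univ (R.observe n₀ m D) n₀

/-- At most `k` calls of GuessM, from call `i` on, with memory `m` and `e` episodes used so far. -/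
def guessRun (P : System X A) (F : QClass X A N) (hH : 0 < H) (R : Resolver X A H N ε Mem)
    (ζ δ : ℝ) : ℕ → ℕ → Mem → ℕ → Measure (Outcome N Mem)
  | 0, _, m, e => Measure.dirac (Sum.inr (m, e))
  | k + 1, i, m, e => (oliveCall P F hH R ζ δ i m).bind <| Sum.elim
      (fun o => Measure.dirac (Sum.inl (o.1, e + o.2)))
      (fun o => guessRun P F hH R ζ δ k (i + 1) o.1 (e + o.2))

/-- The probability that GuessM, started with memory `m`, halts, returns the greedy policy of some
`f`, and uses some number `e` of episodes, with `(f, e) ∈ G`. -/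
def guessProb (P : System X A) (F : QClass X A N) (hH : 0 < H) (R : Resolver X A H N ε Mem)
    (ζ δ : ℝ) (m : Mem) (G : Set (Fin N × ℕ)) : ENNReal :=
  ⨆ k : ℕ, guessRun P F hH R ζ δ k 1 m 0 (Sum.inl '' G)

end Algorithm

end CDP

end

/-! OLIVE is optimistic. The function it tries maximizes the estimated value among the survivors, a
valid function predicts its own value exactly, and predicted minus actual value telescopes into the
sum of the Bellman errors on the function's own roll-in (`QClass.predValue_sub_value`). So, if all
estimates are accurate, either the estimated errors are small and the policy is near-optimal
(`QClass.mem_nearOpt`), or some level has Bellman error at least `ε / (2H)` and an elimination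
follows, which never removes a valid function. None of this needs the guess `M'` to be right: a
wrong guess can make a call fail, but not return a bad policy (`oliveLoop_compl_goodOutcome_le`).

Only halting needs a large guess. Survivors have Bellman error at most `2φ = ε / (6H√M')` on the
earlier roll-ins at the levels eliminated there, while the tried function has `ε / (2H)` on its own;
the squares differ by the factor `9M'`. In the true dimension `M`, each elimination at a level
therefore at least doubles the determinant of the regularized sum of outer products of the vectors
`ν`, as long as there are at most `9M'` of them, whereas the determinant is at most the `M`-th power
of the trace (`two_pow_length_le_of_pairwise`). Once `M' ≥ 32 M (1 + log (M H ζ / ε))`, this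
excludes `2M'` eliminations at one level, and the cap on the iterations is at least `2HM'`. Doubling
reaches such a guess within a logarithmic factor of `M`.

Accuracy comes from Hoeffding's inequality for the predicted values and the on-policy errors, and
from a Bernstein bound for the importance weighted errors, whose second moment is linear in `K`. A
union bound gives each call failure probability at most `δ / (i (i + 1))`, and these sum to at most
`δ` (`guessRun_compl_le`). -/

noncomputable section

namespace CDP

/-! ### Steps of an episode. -/

section Episode

variable {X A : Type*}

/-- Append a step to a history. -/
def Hist.extend {h : ℕ} (z : (Hist X A h × A) × (ℝ × X)) : Hist X A (h + 1) :=
  (Fin.snoc (α := fun _ => X × A × ℝ) z.1.1.1 (z.1.1.2, z.1.2, z.2.1), z.2.2)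

/-- Step `h` of an episode, and the context that follows. -/
def outcome {H : ℕ} (τ : Traj X A H) (h : Fin H) : (X × A × ℝ) × X :=
  (τ.1 h, if hh : h.1 + 1 < H then ctx τ ⟨h.1 + 1, hh⟩ else τ.2)

theorem outcome_extend_castSucc {H : ℕ} (z : (Hist X A H × A) × (ℝ × X)) (h : Fin H) :
    outcome (Hist.extend z) h.castSucc = outcome z.1.1 h := by
  have hlt : h.1 < H := h.2
  unfold outcome Hist.extend ctx
  refine Prod.ext (by simp) ?_
  by_cases hh : h.1 + 1 < H
  · have h1 : (⟨h.1 + 1, by omega⟩ : Fin (H + 1)) = Fin.castSucc ⟨h.1 + 1, hh⟩ := rfl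
    simp [hh, h1, -Fin.castSucc_mk]
  · have h1 : (⟨h.1 + 1, by omega⟩ : Fin (H + 1)) = Fin.last H := by
      ext; simp; omega
    simp [hh, h1]

theorem outcome_extend_last {H : ℕ} (z : (Hist X A H × A) × (ℝ × X)) :
    outcome (Hist.extend z) (Fin.last H) = ((z.1.1.2, z.1.2, z.2.1), z.2.2) := by
  unfold outcome Hist.extend
  simp

end Episode

/-! ### Laws of episodes and importance weighting. -/

section Rollout

variable {X A : Type*} [MeasurableSpace X] [MeasurableSpace A]

theorem Hist.measurable_extend (h : ℕ) : Measurable (Hist.extend (X := X) (A := A) (h := h)) := by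
  refine Measurable.prodMk ?_ (by fun_prop)
  refine measurable_pi_iff.2 fun i => ?_
  induction i using Fin.lastCases with
  | last => simpa using by fun_prop
  | cast i => simpa using by fun_prop

theorem System.rollout_succ (P : System X A) (β : Rule X A) (h : ℕ) :
    P.rollout β (h + 1) = ((P.rollout β h ⊗ₘ β.act h) ⊗ₘ P.step h).map Hist.extend := rfl

instance System.isProbabilityMeasure_rollout (P : System X A) (β : Rule X A) (h : ℕ) :
    IsProbabilityMeasure (P.rollout β h) := by
  induction h with
  | zero =>
    exact Measure.isProbabilityMeasure_map (by fun_prop)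
  | succ h ih =>
    rw [System.rollout_succ]
    exact Measure.isProbabilityMeasure_map (Hist.measurable_extend h).aemeasurable

theorem System.rollout_congr (P : System X A) {β β' : Rule X A} {h : ℕ}
    (hβ : ∀ k < h, β.act k = β'.act k) : P.rollout β h = P.rollout β' h := by
  induction h with
  | zero => rfl
  | succ h ih =>
    rw [System.rollout_succ, System.rollout_succ, ih fun k hk => hβ k (by omega),
      hβ h (by omega)]

theorem measurable_ctx {H : ℕ} (h : Fin H) : Measurable fun τ : Traj X A H => ctx τ h := by
  unfold ctx; fun_prop

theorem measurable_action {H : ℕ} (h : Fin H) : Measurable fun τ : Traj X A H => action τ h := by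
  unfold action; fun_prop

theorem measurable_reward {H : ℕ} (h : Fin H) : Measurable fun τ : Traj X A H => reward τ h := by
  unfold reward; fun_prop

theorem measurable_outcome {H : ℕ} (h : Fin H) : Measurable fun τ : Traj X A H => outcome τ h := by
  unfold outcome
  refine Measurable.prodMk (by fun_prop) ?_
  split_ifs
  · exact measurable_ctx _
  · fun_prop

/-- All later steps come from Markov kernels and integrate out, so level `h` can be studied on its
own, whatever the rule does afterwards. -/
theorem System.map_outcome (P : System X A) (β : Rule X A) {H : ℕ} (h : Fin H) :
    (P.rollout β H).map (fun τ => outcome τ h) =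
      ((P.rollout β h ⊗ₘ β.act h) ⊗ₘ P.step h).map
        fun z => ((z.1.1.2, z.1.2, z.2.1), z.2.2) := by
  induction H with
  | zero => exact h.elim0
  | succ H ih =>
    rw [System.rollout_succ, Measure.map_map (measurable_outcome h) (Hist.measurable_extend H)]
    induction h using Fin.lastCases with
    | last =>
      congr 1
      funext z
      exact outcome_extend_last z
    | cast h =>
      rw [Fin.val_castSucc, ← ih h]
      have : (fun τ => outcome τ h.castSucc) ∘ Hist.extend =
          (fun τ : Traj X A H => outcome τ h) ∘ (Prod.fst ∘ Prod.fst) := by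
        funext z
        exact outcome_extend_castSucc z h
      rw [this, ← Measure.map_map (measurable_outcome h) (by fun_prop),
        ← Measure.map_map (by fun_prop) (by fun_prop)]
      congr 1
      change ((Measure.fst _).fst) = _
      rw [Measure.fst_compProd, Measure.fst_compProd]

theorem lintegral_map_outcome (P : System X A) (β : Rule X A) {H : ℕ} (h : Fin H)
    {g : (X × A × ℝ) × X → ENNReal} (hg : Measurable g) :
    ∫⁻ τ, g (outcome τ h) ∂(P.rollout β H) =
      ∫⁻ s, ∫⁻ a, ∫⁻ y, g ((s.2, a, y.1), y.2) ∂(P.step h (s, a)) ∂(β.act h s)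
        ∂(P.rollout β h) := by
  rw [← lintegral_map hg (measurable_outcome h), P.map_outcome β h, lintegral_map hg (by fun_prop),
    Measure.lintegral_compProd (by fun_prop), Measure.lintegral_compProd]
  exact Measurable.lintegral_kernel_prod_right' (κ := P.step h)
    (f := fun z => g ((z.1.1.2, z.1.2, z.2.1), z.2.2)) (by fun_prop)

theorem rollout_switch_eq_explore [Fintype A] [Nonempty A] (P : System X A) (π π' : Policy X A)
    (h : ℕ) :
    P.rollout (Rule.switch π π' h) h = P.rollout (Rule.explore π h) h := by
  refine P.rollout_congr fun k hk => ?_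
  change playKernel (if k < h then π else π') k =
    if k = h then Kernel.const _ (PMF.uniformOfFintype A).toMeasure else playKernel π k
  rw [if_pos hk, if_neg hk.ne]

section Discrete

variable [DiscreteMeasurableSpace A] [Fintype A]

theorem measurableSet_action_eq {Ω : Type*} [MeasurableSpace Ω] {a b : Ω → A} (ha : Measurable a)
    (hb : Measurable b) : MeasurableSet {ω | a ω = b ω} :=
  (ha.prodMk hb) (MeasurableSet.of_discrete (s := {p : A × A | p.1 = p.2}))

theorem System.ae_action_eq (P : System X A) (π : ℕ → Policy X A) (H : ℕ) :
    ∀ᵐ τ ∂(P.rollout (Rule.ofPolicies π) H), ∀ h : Fin H, action τ h = (π h).1 (ctx τ h) := by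
  refine ae_all_iff.2 fun h => ?_
  have hm : MeasurableSet {o : (X × A × ℝ) × X | o.1.2.1 = (π h).1 o.1.1} :=
    measurableSet_action_eq (by fun_prop) ((π h).2.comp (by fun_prop))
  have key : ∀ᵐ o ∂((P.rollout (Rule.ofPolicies π) H).map fun τ => outcome τ h),
      o.1.2.1 = (π h).1 o.1.1 := by
    rw [P.map_outcome, ae_map_iff (by fun_prop) hm]
    have h2 : ∀ᵐ z ∂(P.rollout (Rule.ofPolicies π) h ⊗ₘ (Rule.ofPolicies π).act h),
        z.2 = (π h).1 z.1.2 := by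
      change ∀ᵐ z ∂(P.rollout (Rule.ofPolicies π) h ⊗ₘ playKernel (π h) h), _
      unfold playKernel
      rw [Measure.compProd_deterministic, ae_map_iff]
      · simp
      · exact (Measurable.prodMk measurable_id ((π h).2.comp measurable_snd)).aemeasurable
      · exact measurableSet_action_eq (by fun_prop) ((π h).2.comp (by fun_prop))
    exact Measure.ae_compProd_of_ae_fst _
      (measurableSet_action_eq (by fun_prop) ((π h).2.comp (by fun_prop))) h2
  exact ae_of_ae_map (measurable_outcome h).aemeasurable key

open Classical in
/-- The importance weight of a step whose action was uniformly random, for the policy `π`. -/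
def impWeight (π : Policy X A) (o : (X × A × ℝ) × X) : NNReal :=
  if o.1.2.1 = π.1 o.1.1 then (Fintype.card A : NNReal) else 0

theorem measurable_impWeight (π : Policy X A) : Measurable (impWeight π) := by
  unfold impWeight
  exact Measurable.ite (measurableSet_action_eq (by fun_prop) (π.2.comp (by fun_prop)))
    measurable_const measurable_const

variable [Nonempty A]

theorem lintegral_uniformOfFintype (g : A → ENNReal) :
    ∫⁻ a, g a ∂(PMF.uniformOfFintype A).toMeasure = ∑ a, g a * (Fintype.card A : ENNReal)⁻¹ := by
  rw [lintegral_fintype]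
  refine Finset.sum_congr rfl fun a _ => ?_
  rw [PMF.toMeasure_apply_singleton _ _ (measurableSet_singleton a),
    PMF.uniformOfFintype_apply]

/-- Both rules play `π` before `h`, and `outcome` does not see the actions after level `h`. At level
`h`, averaging `K · 1[a = π' x]` over the uniform action leaves exactly the term `a = π' x`. -/
theorem map_outcome_switch (P : System X A) (π π' : Policy X A) {H : ℕ} (h : Fin H) :
    (P.rollout (Rule.switch π π' h) H).map (fun τ => outcome τ h) =
      ((P.rollout (Rule.explore π h) H).map fun τ => outcome τ h).withDensity
        fun o => impWeight π' o := by
  have hw : Measurable fun o : (X × A × ℝ) × X => (impWeight π' o : ENNReal) :=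
    (measurable_impWeight π').coe_nnreal_ennreal
  ext B hB
  have hi : Measurable (B.indicator (1 : (X × A × ℝ) × X → ENNReal)) :=
    measurable_one.indicator hB
  rw [withDensity_apply _ hB, ← lintegral_indicator hB, ← lintegral_indicator_one hB,
    lintegral_map hi (measurable_outcome h), lintegral_map (hw.indicator hB) (measurable_outcome h),
    lintegral_map_outcome _ _ _ hi, lintegral_map_outcome _ _ _ (hw.indicator hB),
    rollout_switch_eq_explore]
  refine lintegral_congr fun s => ?_
  have h1 : (Rule.switch π π' h).act h = playKernel π' h := by
    change playKernel (if h.1 < h.1 then π else π') h = _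
    rw [if_neg (lt_irrefl _)]
  have h2 : (Rule.explore π h).act h =
      Kernel.const (Hist X A h) (PMF.uniformOfFintype A).toMeasure := by
    change (if h.1 = h.1 then Kernel.const _ (PMF.uniformOfFintype A).toMeasure
      else playKernel π h) = _
    rw [if_pos rfl]
  rw [h1, h2, Kernel.const_apply, lintegral_uniformOfFintype]
  unfold playKernel
  rw [Kernel.lintegral_deterministic']
  · rw [Finset.sum_eq_single (π'.1 s.2)]
    · have : ∀ y : ℝ × X, B.indicator (fun o => (impWeight π' o : ENNReal))
          ((s.2, π'.1 s.2, y.1), y.2) =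
          (Fintype.card A : ENNReal) * B.indicator 1 ((s.2, π'.1 s.2, y.1), y.2) := by
        intro y
        by_cases hy : ((s.2, π'.1 s.2, y.1), y.2) ∈ B <;> simp [impWeight, hy]
      simp_rw [this]
      rw [lintegral_const_mul]
      · rw [mul_comm, ← mul_assoc, ENNReal.inv_mul_cancel (by simp) (by simp), one_mul]
      · exact hi.comp (by fun_prop)
    · intro a _ ha
      have : ∀ y : ℝ × X, B.indicator (fun o => (impWeight π' o : ENNReal))
          ((s.2, a, y.1), y.2) = 0 := by
        intro y
        simp [impWeight, ha]
      simp [this]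
    · simp
  · exact measurable_of_countable _ 

/-- Importance weighting turns a uniformly random action into that of `π'`. -/
theorem integral_impWeight (P : System X A) (π π' : Policy X A) {H : ℕ} (h : Fin H)
    {g : (X × A × ℝ) × X → ℝ} (hg : Measurable g) :
    ∫ τ, (impWeight π' (outcome τ h) : ℝ) * g (outcome τ h) ∂(P.rollout (Rule.explore π h) H) =
      ∫ τ, g (outcome τ h) ∂(P.rollout (Rule.switch π π' h) H) := by
  rw [← integral_map (measurable_outcome h).aemeasurable hg.aestronglyMeasurable,
    map_outcome_switch, integral_withDensity_eq_integral_smul (measurable_impWeight π'),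
    integral_map (measurable_outcome h).aemeasurable]
  · rfl
  · exact ((measurable_impWeight π').smul hg).aestronglyMeasurable

end Discrete

end Rollout

end CDP

namespace CDP

/-! ### Bellman residuals and the decomposition of the value. -/

section Residual

variable {X A : Type*} [MeasurableSpace X] [MeasurableSpace A] {N H : ℕ}

/-- The Bellman residual of `f` at level `h`, as a function of the step and the next context, when
the next action is greedy. -/
def QClass.residual (F : QClass X A N) (f : Fin N) (h : Fin H) (o : (X × A × ℝ) × X) : ℝ :=
  F.val f o.1.1 o.1.2.1 - o.1.2.2 - if h.1 + 1 < H then F.val f o.2 ((F.greedy f).1 o.2) else 0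

/-- The Bellman residual of `f` at level `h` of an episode, with the next action that was taken. -/
def QClass.residualTaken (F : QClass X A N) (f : Fin N) (h : Fin H) (τ : Traj X A H) : ℝ :=
  F.val f (ctx τ h) (action τ h) - reward τ h - F.nextTaken f τ h

/-- The value of `f` at the first context of an episode, for the greedy action. -/
def QClass.initVal (F : QClass X A N) (hH : 0 < H) (f : Fin N) (τ : Traj X A H) : ℝ :=
  F.val f (ctx τ ⟨0, hH⟩) ((F.greedy f).1 (ctx τ ⟨0, hH⟩))

/-- The value that `f` predicts for its greedy policy. -/
def QClass.predValue (F : QClass X A N) (P : System X A) (f : Fin N) : ℝ :=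
  ∫ x, F.val f x ((F.greedy f).1 x) ∂P.init

theorem QClass.residual_outcome (F : QClass X A N) (f : Fin N) (h : Fin H) (τ : Traj X A H) :
    F.residual f h (outcome τ h) =
      F.val f (ctx τ h) (action τ h) - reward τ h - F.nextGreedy f τ h := by
  unfold QClass.residual QClass.nextGreedy outcome
  by_cases hh : h.1 + 1 < H <;> simp [hh, ctx, action, reward]

theorem QClass.nextTaken_mem (F : QClass X A N) (f : Fin N) (h : Fin H) (τ : Traj X A H) :
    F.nextTaken f τ h ∈ Set.Icc (0 : ℝ) 1 := by
  unfold QClass.nextTaken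
  split_ifs
  · exact F.val_mem _ _ _
  · simp

theorem QClass.nextGreedy_mem (F : QClass X A N) (f : Fin N) (h : Fin H) (τ : Traj X A H) :
    F.nextGreedy f τ h ∈ Set.Icc (0 : ℝ) 1 := by
  unfold QClass.nextGreedy
  split_ifs
  · exact F.val_mem _ _ _
  · simp

theorem System.RewardsBounded.ae_reward_mem {P : System X A} (hP : P.RewardsBounded H)
    (β : Rule X A) : ∀ᵐ τ ∂(P.rollout β H), ∀ h, reward τ h ∈ Set.Icc (0 : ℝ) 1 := by
  filter_upwards [hP β] with τ hτ h
  exact ⟨hτ.1 h, (Finset.single_le_sum (fun i _ => hτ.1 i) (Finset.mem_univ h)).trans hτ.2⟩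

theorem QClass.ae_residualTaken_mem (F : QClass X A N) {P : System X A} (hP : P.RewardsBounded H)
    (β : Rule X A) (f : Fin N) (h : Fin H) :
    ∀ᵐ τ ∂(P.rollout β H), F.residualTaken f h τ ∈ Set.Icc (-2 : ℝ) 1 := by
  filter_upwards [hP.ae_reward_mem β] with τ hτ
  have h1 := hτ h
  have h2 := F.nextTaken_mem f h τ
  have h3 := F.val_mem f (ctx τ h) (action τ h)
  unfold QClass.residualTaken
  constructor <;> linarith [h1.1, h1.2, h2.1, h2.2, h3.1, h3.2]

theorem QClass.ae_abs_residual_le (F : QClass X A N) {P : System X A} (hP : P.RewardsBounded H)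
    (β : Rule X A) (f : Fin N) (h : Fin H) :
    ∀ᵐ τ ∂(P.rollout β H), |F.residual f h (outcome τ h)| ≤ 2 := by
  filter_upwards [hP.ae_reward_mem β] with τ hτ
  have h1 := hτ h
  have h2 := F.nextGreedy_mem f h τ
  have h3 := F.val_mem f (ctx τ h) (action τ h)
  rw [F.residual_outcome, abs_le]
  constructor <;> linarith [h1.1, h1.2, h2.1, h2.2, h3.1, h3.2]

/-- The next value at level `h` cancels the current value at level `h + 1`; the convention beyond
the last level removes the final term. -/
theorem QClass.sum_residualTaken (F : QClass X A N) (hH : 0 < H) (f : Fin N) (τ : Traj X A H) :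
    ∑ h, F.residualTaken f h τ =
      F.val f (ctx τ ⟨0, hH⟩) (action τ ⟨0, hH⟩) - ∑ h, reward τ h := by
  set u : ℕ → ℝ := fun k =>
    if hk : k < H then F.val f (ctx τ ⟨k, hk⟩) (action τ ⟨k, hk⟩) else 0 with hu
  have h1 : ∀ h : Fin H, F.residualTaken f h τ = (u h - u (h + 1)) - reward τ h := by
    intro h
    unfold QClass.residualTaken QClass.nextTaken
    simp only [hu, h.2, dif_pos]
    ring
  simp_rw [h1]
  rw [Finset.sum_sub_distrib, Fin.sum_univ_eq_sum_range (fun k => u k - u (k + 1)) H,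
    Finset.sum_range_sub']
  simp [hu, hH]

theorem Rule.switch_self (π : Policy X A) (h : ℕ) : Rule.switch π π h = Rule.follow π := by
  unfold Rule.switch Rule.follow
  simp

theorem QClass.bellmanError_self (F : QClass X A N) (P : System X A) (f : Fin N) (h : Fin H) :
    F.bellmanError P f (F.greedy f) h =
      ∫ τ, F.residualTaken f h τ ∂(P.rollout (Rule.follow (F.greedy f)) H) := by
  unfold QClass.bellmanError
  rw [Rule.switch_self]
  rfl

theorem impWeight_le [Fintype A] (π : Policy X A) (o : (X × A × ℝ) × X) :
    (impWeight π o : ℝ) ≤ Fintype.card A := by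
  unfold impWeight
  split_ifs <;> simp

/-- The weight is either `0` or `K`. This is what keeps the second moment below linear in `K`. -/
theorem impWeight_mul_self [Fintype A] (π : Policy X A) (o : (X × A × ℝ) × X) :
    (impWeight π o : ℝ) * impWeight π o = Fintype.card A * impWeight π o := by
  unfold impWeight
  split_ifs <;> simp

/-- The importance weighted residual of `f` at level `h` of an episode. -/
def QClass.weightedResidual [Fintype A] (F : QClass X A N) (f : Fin N) (h : Fin H) (τ : Traj X A H) : ℝ :=
  (impWeight (F.greedy f) (outcome τ h) : ℝ) * F.residual f h (outcome τ h)

theorem QClass.learnError_eq [Fintype A] (F : QClass X A N) {n : ℕ} (D : Fin n → Traj X A H) (f : Fin N)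
    (h : Fin H) : F.learnError D f h = (∑ j, F.weightedResidual f h (D j)) / n := by
  unfold QClass.learnError QClass.weightedResidual
  congr 1
  refine Finset.sum_congr rfl fun j _ => ?_
  rw [F.residual_outcome]
  congr 1
  by_cases hc : ((D j).1 h).2.1 = (F.greedy f).1 ((D j).1 h).1 <;>
    simp [impWeight, outcome, ctx, action, hc]

theorem QClass.ae_abs_weightedResidual_le [Fintype A] (F : QClass X A N) {P : System X A}
    (hP : P.RewardsBounded H) (β : Rule X A) (f : Fin N) (h : Fin H) :
    ∀ᵐ τ ∂(P.rollout β H), |F.weightedResidual f h τ| ≤ 2 * Fintype.card A := by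
  filter_upwards [F.ae_abs_residual_le hP β f h] with τ hτ
  unfold QClass.weightedResidual
  rw [abs_mul, abs_of_nonneg (NNReal.coe_nonneg _), mul_comm]
  exact mul_le_mul hτ (impWeight_le _ _) (NNReal.coe_nonneg _) (by norm_num)

theorem System.map_ctx_zero (P : System X A) (β : Rule X A) (hH : 0 < H) :
    (P.rollout β H).map (fun τ => ctx τ ⟨0, hH⟩) = P.init := by
  have h2 : (fun τ : Traj X A H => ctx τ ⟨0, hH⟩) =
      (fun o : (X × A × ℝ) × X => o.1.1) ∘ fun τ => outcome τ ⟨0, hH⟩ := rfl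
  rw [h2, ← Measure.map_map (by fun_prop) (measurable_outcome _), P.map_outcome,
    Measure.map_map (by fun_prop) (by fun_prop)]
  have h3 : ((fun o : (X × A × ℝ) × X => o.1.1) ∘
      fun z : (Hist X A 0 × A) × (ℝ × X) => ((z.1.1.2, z.1.2, z.2.1), z.2.2)) =
      (fun s : Hist X A 0 => s.2) ∘ Prod.fst ∘ Prod.fst := rfl
  change Measure.map ((fun o : (X × A × ℝ) × X => o.1.1) ∘
      fun z : (Hist X A 0 × A) × (ℝ × X) => ((z.1.1.2, z.1.2, z.2.1), z.2.2))
      ((P.rollout β 0 ⊗ₘ β.act 0) ⊗ₘ P.step 0) = _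
  rw [h3, ← Measure.map_map (by fun_prop) (by fun_prop),
    ← Measure.map_map (by fun_prop) (by fun_prop)]
  change Measure.map _ ((Measure.fst _).fst) = _
  rw [Measure.fst_compProd, Measure.fst_compProd]
  change Measure.map _ (P.init.map _) = _
  rw [Measure.map_map (by fun_prop) (by fun_prop)]
  exact Measure.map_id

section Discrete

variable [DiscreteMeasurableSpace A] [Fintype A]

theorem QClass.measurable_val_uncurry (F : QClass X A N) (f : Fin N) :
    Measurable fun p : X × A => F.val f p.1 p.2 :=
  measurable_from_prod_countable_left fun a => F.measurable_val f a

theorem QClass.measurable_val_comp (F : QClass X A N) (f : Fin N) {Ω : Type*} [MeasurableSpace Ω]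
    {x : Ω → X} {a : Ω → A} (hx : Measurable x) (ha : Measurable a) :
    Measurable fun ω => F.val f (x ω) (a ω) :=
  (F.measurable_val_uncurry f).comp (hx.prodMk ha)

theorem QClass.measurable_residual (F : QClass X A N) (f : Fin N) (h : Fin H) :
    Measurable (F.residual f h) := by
  unfold QClass.residual
  refine ((F.measurable_val_comp f (by fun_prop) (by fun_prop)).sub (by fun_prop)).sub ?_
  split_ifs
  · exact F.measurable_val_comp f (by fun_prop) ((F.greedy f).2.comp (by fun_prop))
  · fun_prop

theorem QClass.measurable_residualTaken (F : QClass X A N) (f : Fin N) (h : Fin H) :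
    Measurable (F.residualTaken f h) := by
  unfold QClass.residualTaken QClass.nextTaken
  refine ((F.measurable_val_comp f (measurable_ctx h) (measurable_action h)).sub
    (measurable_reward h)).sub ?_
  split_ifs
  · exact F.measurable_val_comp f (measurable_ctx _) (measurable_action _)
  · fun_prop

theorem QClass.measurable_initVal (F : QClass X A N) (hH : 0 < H) (f : Fin N) :
    Measurable (F.initVal hH f) :=
  F.measurable_val_comp f (measurable_ctx _) ((F.greedy f).2.comp (measurable_ctx _))

theorem QClass.integral_initVal (F : QClass X A N) (P : System X A) (β : Rule X A) (hH : 0 < H)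
    (f : Fin N) : ∫ τ, F.initVal hH f τ ∂(P.rollout β H) = F.predValue P f := by
  have hm : Measurable fun x => F.val f x ((F.greedy f).1 x) :=
    F.measurable_val_comp f measurable_id (F.greedy f).2
  unfold QClass.predValue
  rw [← P.map_ctx_zero β hH,
    integral_map (measurable_ctx _).aemeasurable hm.aestronglyMeasurable]
  rfl

/-- From level `h` on the roll-in plays `π_f`, so the next action is almost surely greedy and the
residual is a function of `outcome` alone. Hence it can be estimated from episodes whose action at
level `h + 1` was chosen by another policy. -/
theorem QClass.bellmanError_eq_integral_residual (F : QClass X A N) (P : System X A) (f : Fin N)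
    (π : Policy X A) (h : Fin H) :
    F.bellmanError P f π h =
      ∫ τ, F.residual f h (outcome τ h) ∂(P.rollout (Rule.switch π (F.greedy f) h) H) := by
  unfold QClass.bellmanError
  refine integral_congr_ae ?_
  filter_upwards [P.ae_action_eq (fun k => if k < h.1 then π else F.greedy f) H] with τ hτ
  rw [F.residual_outcome]
  congr 1
  unfold QClass.nextTaken QClass.nextGreedy
  split_ifs with hh
  · rw [hτ ⟨h.1 + 1, hh⟩, if_neg (by simp)]
  · rfl

/-- On its own roll-in, the Bellman errors of `f` at all levels are expectations under one and the
same law, so the residuals may be added path by path, where they telescope. -/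
theorem QClass.predValue_sub_value (F : QClass X A N) {P : System X A} (hP : P.RewardsBounded H)
    (hH : 0 < H) (f : Fin N) :
    F.predValue P f - P.value H (F.greedy f) = ∑ h : Fin H, F.bellmanError P f (F.greedy f) h := by
  set μ := P.rollout (Rule.follow (F.greedy f)) H with hμ
  have hi : ∀ h, Integrable (F.residualTaken f h) μ := fun h =>
    Integrable.of_mem_Icc (-2) 1 (F.measurable_residualTaken f h).aemeasurable
      (F.ae_residualTaken_mem hP _ f h)
  have hr : Integrable (fun τ : Traj X A H => ∑ h, reward τ h) μ :=
    integrable_finsetSum _ fun h _ => Integrable.of_mem_Icc 0 1 (measurable_reward h).aemeasurable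
      ((hP.ae_reward_mem _).mono fun τ hτ => hτ h)
  have hv : Integrable (F.initVal hH f) μ :=
    Integrable.of_mem_Icc 0 1 (F.measurable_initVal hH f).aemeasurable
      (Filter.Eventually.of_forall fun τ => F.val_mem _ _ _)
  simp_rw [F.bellmanError_self]
  rw [← integral_finsetSum _ fun h _ => hi h, ← F.integral_initVal P (Rule.follow (F.greedy f)) hH,
    System.value, ← integral_sub hv hr]
  refine integral_congr_ae ?_
  filter_upwards [P.ae_action_eq (fun _ => F.greedy f) H] with τ hτ
  rw [F.sum_residualTaken hH, hτ]
  rfl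

theorem QClass.IsValid.value_eq {F : QClass X A N} {P : System X A} (hP : P.RewardsBounded H)
    (hH : 0 < H) {f : Fin N} (hf : F.IsValid P H f) :
    P.value H (F.greedy f) = F.predValue P f := by
  have := F.predValue_sub_value hP hH f
  rw [Finset.sum_eq_zero fun h _ => hf f h] at this
  linarith

theorem QClass.measurable_weightedResidual (F : QClass X A N) (f : Fin N) (h : Fin H) :
    Measurable (F.weightedResidual f h) :=
  ((measurable_impWeight _).comp (measurable_outcome h)).coe_nnreal_real.mul
    ((F.measurable_residual f h).comp (measurable_outcome h))

variable [Nonempty A]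

theorem QClass.integral_weightedResidual (F : QClass X A N) (P : System X A) (f : Fin N)
    (π : Policy X A) (h : Fin H) :
    ∫ τ, F.weightedResidual f h τ ∂(P.rollout (Rule.explore π h) H) = F.bellmanError P f π h := by
  rw [F.bellmanError_eq_integral_residual]
  exact integral_impWeight P π (F.greedy f) h (F.measurable_residual f h)

/-- One factor `K` leaves the squared weight. The weight that remains changes the law to the one
that plays `π_f` at level `h`, where the squared residual is at most `4`. A pointwise bound would
give `4K²`. -/
theorem QClass.integral_weightedResidual_sq_le (F : QClass X A N) {P : System X A}
    (hP : P.RewardsBounded H) (f : Fin N) (π : Policy X A) (h : Fin H) :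
    ∫ τ, F.weightedResidual f h τ ^ 2 ∂(P.rollout (Rule.explore π h) H) ≤ 4 * Fintype.card A := by
  have h1 : ∀ τ : Traj X A H, F.weightedResidual f h τ ^ 2 = Fintype.card A *
      ((impWeight (F.greedy f) (outcome τ h) : ℝ) * F.residual f h (outcome τ h) ^ 2) := by
    intro τ
    unfold QClass.weightedResidual
    rw [← mul_assoc, ← impWeight_mul_self]
    ring
  simp_rw [h1]
  rw [integral_const_mul, integral_impWeight P π (F.greedy f) h
    (g := fun o => F.residual f h o ^ 2) ((F.measurable_residual f h).pow_const 2), mul_comm]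
  refine mul_le_mul_of_nonneg_right ?_ (by positivity)
  have h2 : ∀ᵐ τ ∂(P.rollout (Rule.switch π (F.greedy f) h) H),
      F.residual f h (outcome τ h) ^ 2 ≤ 4 := by
    filter_upwards [F.ae_abs_residual_le hP _ f h] with τ hτ
    rw [← sq_abs]
    nlinarith [abs_nonneg (F.residual f h (outcome τ h))]
  calc _ ≤ ∫ τ, (4 : ℝ) ∂(P.rollout (Rule.switch π (F.greedy f) h) H) :=
        integral_mono_of_nonneg (Filter.Eventually.of_forall fun _ => sq_nonneg _)
          (integrable_const _) h2
    _ = 4 := by simp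

end Discrete

end Residual

end CDP

/-! ### Concentration of sample averages. -/

section Concentration

variable {Ω : Type*} [MeasurableSpace Ω] {μ : Measure Ω} [IsProbabilityMeasure μ]

theorem measureReal_pi_sum_ge_le {g : Ω → ℝ} (hg : Measurable g) (n : ℕ) {t ψ : ℝ} (u : ℝ)
    (ht : 0 ≤ t) (hi : Integrable (fun ω => Real.exp (t * g ω)) μ) (hψ : mgf g μ t ≤ Real.exp ψ) :
    (Measure.pi fun _ : Fin n => μ).real {D | n * u ≤ ∑ j, g (D j)} ≤
      Real.exp (n * (ψ - t * u)) := by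
  set ν := Measure.pi fun _ : Fin n => μ with hν
  have hmp : ∀ j : Fin n, MeasurePreserving (Function.eval j) ν μ :=
    fun j => measurePreserving_eval (fun _ => μ) j
  have hind : iIndepFun (fun (j : Fin n) (D : Fin n → Ω) => g (D j)) ν :=
    iIndepFun_pi fun _ => hg.aemeasurable
  have hm : ∀ j : Fin n, Measurable fun D : Fin n → Ω => g (D j) := fun j => by fun_prop
  have hmgf : ∀ j : Fin n, mgf (fun D : Fin n → Ω => g (D j)) ν t = mgf g μ t := by
    intro j
    have := mgf_map (μ := ν) (Y := Function.eval j) (X := g) (t := t)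
      (hmp j).measurable.aemeasurable
      (by rw [(hmp j).map_eq]; exact hi.aestronglyMeasurable)
    rw [(hmp j).map_eq] at this
    rw [this]
    rfl
  have hi' : Integrable (fun D : Fin n → Ω => Real.exp (t * (∑ j, fun D : Fin n → Ω => g (D j)) D))
      ν :=
    hind.integrable_exp_mul_sum hm fun j _ => (hmp j).integrable_comp_of_integrable hi
  have h := measure_ge_le_exp_mul_mgf (n * u) ht hi'
  rw [hind.mgf_sum hm, Finset.prod_congr rfl fun j _ => hmgf j, Finset.prod_const,
    Finset.card_univ, Fintype.card_fin] at h
  calc ν.real {D | n * u ≤ ∑ j, g (D j)}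
      = ν.real {D | n * u ≤ (∑ j, fun D : Fin n → Ω => g (D j)) D} := by simp
    _ ≤ _ := h
    _ ≤ Real.exp (-t * (n * u)) * Real.exp ψ ^ n := by
      gcongr
      exact mgf_nonneg
    _ = Real.exp (n * (ψ - t * u)) := by
      rw [← Real.exp_nat_mul, ← Real.exp_add]
      ring_nf

/-- Chernoff's bound on both tails, with the moment generating function bound left as a hypothesis,
so that it serves both the bounded and the small second moment case. -/
theorem pi_abs_avg_sub_gt_le {g : Ω → ℝ} (hg : Measurable g) {n : ℕ} (hn : 0 < n) {t ψ m : ℝ}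
    (u : ℝ) (ht : 0 ≤ t) (hi : Integrable (fun ω => Real.exp (t * (g ω - m))) μ)
    (hi' : Integrable (fun ω => Real.exp (t * (m - g ω))) μ)
    (hψ : mgf (fun ω => g ω - m) μ t ≤ Real.exp ψ)
    (hψ' : mgf (fun ω => m - g ω) μ t ≤ Real.exp ψ) :
    (Measure.pi fun _ : Fin n => μ) {D | u < |(∑ j, g (D j)) / n - m|} ≤
      ENNReal.ofReal (2 * Real.exp (n * (ψ - t * u))) := by
  have h1 := measureReal_pi_sum_ge_le (hg.sub_const m) n u ht hi hψ
  have h2 := measureReal_pi_sum_ge_le (hg.const_sub m) n u ht hi' hψ'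
  have hn' : (0 : ℝ) < n := by exact_mod_cast hn
  have hsub : {D : Fin n → Ω | u < |(∑ j, g (D j)) / n - m|} ⊆
      {D | n * u ≤ ∑ j, (g (D j) - m)} ∪ {D | n * u ≤ ∑ j, (m - g (D j))} := by
    intro D hD
    have h3 : ((∑ j, g (D j)) / n - m) * n = ∑ j, (g (D j) - m) := by
      rw [Finset.sum_sub_distrib, sub_mul, div_mul_cancel₀ _ hn'.ne']
      simp [mul_comm]
    have h4 : ∑ j, (m - g (D j)) = -∑ j, (g (D j) - m) := by
      rw [← Finset.sum_neg_distrib]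
      exact Finset.sum_congr rfl fun _ _ => by ring
    have hD' : u < |(∑ j, g (D j)) / n - m| := hD
    rcases lt_abs.1 hD' with h | h
    · left
      rw [Set.mem_ofPred_eq]
      rw [← h3]
      nlinarith
    · right
      rw [Set.mem_ofPred_eq]
      rw [h4, ← h3]
      nlinarith
  rw [ENNReal.le_ofReal_iff_toReal_le (measure_ne_top _ _) (by positivity)]
  calc _ ≤ (Measure.pi fun _ : Fin n => μ).real
        ({D | n * u ≤ ∑ j, (g (D j) - m)} ∪ {D | n * u ≤ ∑ j, (m - g (D j))}) :=
        measureReal_mono hsub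
    _ ≤ _ := measureReal_union_le _ _
    _ ≤ _ := by linarith

/-- Hoeffding's inequality for the average of an i.i.d. sample. -/
theorem pi_abs_avg_sub_integral_gt_le_of_mem_Icc {g : Ω → ℝ} (hg : Measurable g) {n : ℕ}
    (hn : 0 < n) {a b u : ℝ} (hab : a < b) (hu : 0 ≤ u) (hb : ∀ᵐ ω ∂μ, g ω ∈ Set.Icc a b) :
    (Measure.pi fun _ : Fin n => μ) {D | u < |(∑ j, g (D j)) / n - ∫ ω, g ω ∂μ|} ≤
      ENNReal.ofReal (2 * Real.exp (-(2 * n * u ^ 2 / (b - a) ^ 2))) := by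
  have hsg := hasSubgaussianMGF_of_mem_Icc hg.aemeasurable hb
  have hsg' := hsg.neg
  have hneg : (-fun ω => g ω - ∫ ω, g ω ∂μ) = fun ω => (∫ ω, g ω ∂μ) - g ω := by
    funext ω
    simp
  rw [hneg] at hsg'
  have hba : 0 < b - a := sub_pos.2 hab
  -- The minimizer of `t² (b - a)² / 8 - t u`.
  set t := 4 * u / (b - a) ^ 2 with ht
  have hc : (((‖b - a‖₊ / 2) ^ 2 : NNReal) : ℝ) = (b - a) ^ 2 / 4 := by
    simp only [NNReal.coe_pow, NNReal.coe_div, coe_nnnorm, Real.norm_eq_abs, abs_of_pos hba]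
    norm_num
    ring
  have h := pi_abs_avg_sub_gt_le hg hn u (t := t) (by positivity) (hsg.integrable_exp_mul t)
    (hsg'.integrable_exp_mul t) (hsg.mgf_le t) (hsg'.mgf_le t)
  refine h.trans_eq ?_
  rw [hc, ht]
  congr 3
  field_simp
  ring

/-- Integrate `exp y ≤ 1 + y + y²`, valid for `|y| ≤ 1`, at `y = t g`, and return to an exponential
by `1 + y ≤ exp y`. -/
theorem mgf_sub_integral_le_of_abs_le {g : Ω → ℝ} (hg : Measurable g) {B V t : ℝ} (ht : 0 ≤ t)
    (hB : ∀ᵐ ω ∂μ, |g ω| ≤ B) (hV : ∫ ω, g ω ^ 2 ∂μ ≤ V) (htB : t * B ≤ 1) :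
    mgf (fun ω => g ω - ∫ ω, g ω ∂μ) μ t ≤ Real.exp (t ^ 2 * V) := by
  set m := ∫ ω, g ω ∂μ with hm
  have hi : Integrable g μ := Integrable.of_bound hg.aestronglyMeasurable B hB
  have hi2 : Integrable (fun ω => g ω ^ 2) μ := by
    refine Integrable.of_bound (hg.pow_const 2).aestronglyMeasurable (B ^ 2) ?_
    filter_upwards [hB] with ω hω
    rw [Real.norm_eq_abs, abs_pow]
    gcongr
  have h1 : ∫ ω, Real.exp (t * g ω) ∂μ ≤ ∫ ω, (1 + t * g ω + t ^ 2 * g ω ^ 2) ∂μ := by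
    refine integral_mono_of_nonneg (Filter.Eventually.of_forall fun _ => (Real.exp_pos _).le)
      (((integrable_const _).add (hi.const_mul t)).add (hi2.const_mul _)) ?_
    filter_upwards [hB] with ω hω
    have h2 : |t * g ω| ≤ 1 := by
      rw [abs_mul, abs_of_nonneg ht]
      exact (mul_le_mul_of_nonneg_left hω ht).trans htB
    have h3 := (abs_le.1 (Real.abs_exp_sub_one_sub_id_le h2)).2
    nlinarith
  have h2 : ∫ ω, (1 + t * g ω + t ^ 2 * g ω ^ 2) ∂μ = 1 + t * m + t ^ 2 * ∫ ω, g ω ^ 2 ∂μ := by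
    have h0 : Integrable (fun ω => 1 + t * g ω) μ := (integrable_const _).add (hi.const_mul t)
    rw [integral_add h0 (hi2.const_mul _), integral_add (integrable_const _) (hi.const_mul t), integral_const_mul, integral_const_mul]
    simp [hm]
  have h3 : mgf (fun ω => g ω - m) μ t = (∫ ω, Real.exp (t * g ω) ∂μ) * Real.exp (-(t * m)) := by
    rw [mgf, ← integral_mul_const]
    refine integral_congr_ae (Filter.Eventually.of_forall fun ω => ?_)
    change _ = Real.exp _ * Real.exp _
    rw [← Real.exp_add]
    ring_nf
  rw [h3]
  calc _ ≤ Real.exp (t * m + t ^ 2 * V) * Real.exp (-(t * m)) := by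
        gcongr
        rw [h2] at h1
        have h4 := Real.add_one_le_exp (t * m + t ^ 2 * V)
        nlinarith [mul_le_mul_of_nonneg_left hV (sq_nonneg t)]
    _ = _ := by
        rw [← Real.exp_add]
        ring_nf

/-- A form of Bernstein's inequality for the average of an i.i.d. sample. -/
theorem pi_abs_avg_sub_integral_gt_le_of_sq {g : Ω → ℝ} (hg : Measurable g) {n : ℕ}
    (hn : 0 < n) {B V u : ℝ} (hV0 : 0 < V) (hu : 0 ≤ u) (hB : ∀ᵐ ω ∂μ, |g ω| ≤ B)
    (hV : ∫ ω, g ω ^ 2 ∂μ ≤ V) (huB : u * B ≤ 2 * V) :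
    (Measure.pi fun _ : Fin n => μ) {D | u < |(∑ j, g (D j)) / n - ∫ ω, g ω ∂μ|} ≤
      ENNReal.ofReal (2 * Real.exp (-(n * u ^ 2 / (4 * V)))) := by
  set m := ∫ ω, g ω ∂μ with hm
  -- The minimizer of `t² V - t u`. The hypothesis `u * B ≤ 2 * V` says that `t * B ≤ 1` for this
  -- `t`.
  set t := u / (2 * V) with ht
  have ht0 : 0 ≤ t := by positivity
  have htB : t * B ≤ 1 := by
    rw [ht, div_mul_eq_mul_div, div_le_one (by positivity)]
    exact huB
  have hI : ∀ᵐ ω ∂μ, g ω - m ∈ Set.Icc (-B - m) (B - m) := by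
    filter_upwards [hB] with ω hω
    have := abs_le.1 hω
    constructor <;> linarith [this.1, this.2]
  have hI' : ∀ᵐ ω ∂μ, m - g ω ∈ Set.Icc (-B + m) (B + m) := by
    filter_upwards [hB] with ω hω
    have := abs_le.1 hω
    constructor <;> linarith [this.1, this.2]
  have h1 := mgf_sub_integral_le_of_abs_le hg ht0 hB hV htB
  have h2 := mgf_sub_integral_le_of_abs_le (g := fun ω => -g ω) hg.neg ht0
    (by simpa using hB) (by simpa using hV) htB
  have h3 : (fun ω => -g ω - ∫ ω, -g ω ∂μ) = fun ω => m - g ω := by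
    funext ω
    rw [integral_neg]
    ring
  rw [h3] at h2
  refine (pi_abs_avg_sub_gt_le hg hn u ht0 (integrable_exp_mul_of_mem_Icc
    (hg.sub_const m).aemeasurable hI) (integrable_exp_mul_of_mem_Icc
    (hg.const_sub m).aemeasurable hI') h1 h2).trans_eq ?_
  rw [ht]
  congr 3
  field_simp
  ring

end Concentration

/-! ### Measurability and union bounds for `Measure.bind`. -/

section Bind

variable {α β γ : Type*} [MeasurableSpace α] [MeasurableSpace β] [MeasurableSpace γ]

/-- The discrete choices of the algorithm (function, level, surviving set, episode count) take
countably many values, so measurability may be checked with the choice held fixed. -/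
theorem measurable_of_countable_cases {ι : Type*} [Countable ι] {s : α → ι}
    (hs : ∀ i, MeasurableSet {a | s a = i}) {g : ι → α → β} (hg : ∀ i, Measurable (g i)) :
    Measurable fun a => g (s a) a := by
  intro B hB
  have : (fun a => g (s a) a) ⁻¹' B = ⋃ i, {a | s a = i} ∩ g i ⁻¹' B := by
    ext a
    simp
  rw [this]
  exact MeasurableSet.iUnion fun i => (hs i).inter (hg i hB)

theorem measurable_bind_prodMk {μ : Measure β} [SFinite μ] {g : α × β → Measure γ}
    (hg : Measurable g) : Measurable fun a => μ.bind fun b => g (a, b) := by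
  refine Measure.measurable_of_measurable_coe _ fun B hB => ?_
  have h1 : ∀ a, (μ.bind fun b => g (a, b)) B = ∫⁻ b, g (a, b) B ∂μ := fun a =>
    Measure.bind_apply hB (hg.comp measurable_prodMk_left).aemeasurable
  simp_rw [h1]
  exact ((Measure.measurable_coe hB).comp hg).lintegral_prod_right'

theorem isProbabilityMeasure_bind_prodMk {μ : Measure β} [IsProbabilityMeasure μ]
    {g : α × β → Measure γ} (hg : Measurable g) (h : ∀ z, IsProbabilityMeasure (g z)) (a : α) :
    IsProbabilityMeasure (μ.bind fun b => g (a, b)) :=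
  isProbabilityMeasure_bind (hg.comp measurable_prodMk_left).aemeasurable
    (Filter.Eventually.of_forall fun b => h (a, b))

theorem bind_apply_le_one {μ : Measure α} [IsProbabilityMeasure μ] {f : α → Measure β} {s : Set β}
    (hs : MeasurableSet s) (hf : ∀ a, f a s ≤ 1) : μ.bind f s ≤ 1 :=
  (Measure.bind_apply_le _ hs).trans ((lintegral_mono hf).trans (by simp))

/-- The union bound for one stage of sampling. Neither `f` nor `E` has to be measurable: the
integral bound for `bind` is an inequality, and `E` is replaced by its measurable hull. -/
theorem bind_apply_le_add {μ : Measure α} [IsProbabilityMeasure μ] {f : α → Measure β}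
    {E : Set α} {s : Set β} (hs : MeasurableSet s) (hf : ∀ a, f a s ≤ 1)
    {a b : ENNReal} (hE : μ E ≤ a) (hb : ∀ x ∉ E, f x s ≤ b) : μ.bind f s ≤ a + b := by
  have hle : ∀ x, f x s ≤ (toMeasurable μ E).indicator 1 x + b := by
    intro x
    by_cases hx : x ∈ E
    · have := subset_toMeasurable μ E hx
      simp only [Set.indicator_of_mem ‹x ∈ toMeasurable μ E›, Pi.one_apply]
      exact (hf x).trans le_self_add
    · exact (hb x hx).trans le_add_self
  calc μ.bind f s ≤ ∫⁻ x, f x s ∂μ := Measure.bind_apply_le _ hs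
    _ ≤ ∫⁻ x, ((toMeasurable μ E).indicator 1 x + b) ∂μ := lintegral_mono hle
    _ = μ E + b := by
      rw [lintegral_add_right _ measurable_const,
        lintegral_indicator_one (measurableSet_toMeasurable μ E), measure_toMeasurable]
      simp
    _ ≤ a + b := by gcongr

end Bind

namespace CDP

/-! ### The algorithm defines probability measures. -/

section Measurability

variable {X A : Type*} [MeasurableSpace X] [MeasurableSpace A] [DiscreteMeasurableSpace A]
  [Fintype A] {N H : ℕ}

theorem QClass.measurable_evalError (F : QClass X A N) (n : ℕ) (f : Fin N) (h : Fin H) :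
    Measurable fun D : Fin n → Traj X A H => F.evalError D f h :=
  (Finset.measurable_sum _ fun j _ =>
    (F.measurable_residualTaken f h).comp (measurable_pi_apply j)).div_const _

theorem QClass.measurable_learnError (F : QClass X A N) (n : ℕ) (f : Fin N) (h : Fin H) :
    Measurable fun D : Fin n → Traj X A H => F.learnError D f h := by
  simp_rw [F.learnError_eq]
  exact (Finset.measurable_sum _ fun j _ =>
    (F.measurable_weightedResidual f h).comp (measurable_pi_apply j)).div_const _

theorem QClass.measurable_empValue (F : QClass X A N) (hH : 0 < H) (n : ℕ) :
    Measurable fun D : Fin n → Traj X A H => F.empValue hH D :=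
  measurable_pi_iff.2 fun f => (Finset.measurable_sum _ fun j _ =>
    (F.measurable_initVal hH f).comp (measurable_pi_apply j)).div_const _

open Classical in
theorem QClass.measurableSet_filter_learnError_eq (F : QClass X A N) (n : ℕ) (h : Fin H) (φ : ℝ)
    (S S' : Finset (Fin N)) :
    MeasurableSet {E : Fin n → Traj X A H | (S.filter fun g => |F.learnError E g h| ≤ φ) = S'} := by
  have h1 : {E : Fin n → Traj X A H | (S.filter fun g => |F.learnError E g h| ≤ φ) = S'} =
      ⋂ g, {E | (g ∈ S ∧ |F.learnError E g h| ≤ φ) ↔ g ∈ S'} := by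
    ext E
    simp [Finset.ext_iff]
  rw [h1]
  refine MeasurableSet.iInter fun g => ?_
  have h2 : MeasurableSet {E : Fin n → Traj X A H | |F.learnError E g h| ≤ φ} :=
    measurableSet_le (F.measurable_learnError n g h).abs measurable_const
  by_cases hg : g ∈ S <;> by_cases hg' : g ∈ S'
  · simpa [hg, hg'] using h2
  · simp only [hg, hg', true_and, iff_false]
    exact h2.compl
  · simp [hg, hg']
  · simp [hg, hg']

variable [Nonempty A] {ε : ℝ} {Mem : Type*} [MeasurableSpace Mem]

/-- `Measure.bind` degenerates to zero along a non-measurable function, so total mass one has to be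
proved; it is what turns upper bounds for bad outcomes into a lower bound for success. Mass one at
`t + 1` uses measurability at `t`, hence the joint induction. -/
theorem measurable_oliveLoop_and_isProbabilityMeasure (P : System X A) (F : QClass X A N) (R : Resolver X A H N ε Mem)
    (neval nlearn : ℕ) (φ : ℝ) (t : ℕ) (S : Finset (Fin N)) :
    (Measurable fun q : (Fin N → ℝ) × Mem × ℕ =>
      oliveLoop P F R neval nlearn φ q.1 t S q.2.1 q.2.2) ∧
    ∀ v m e, IsProbabilityMeasure (oliveLoop P F R neval nlearn φ v t S m e) := by
  induction t generalizing S with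
  | zero =>
    simp only [oliveLoop]
    exact ⟨Measure.measurable_dirac.comp (by fun_prop), fun _ _ _ => inferInstance⟩
  | succ t ih =>
    simp only [oliveLoop]
    split_ifs with hS
    · exact ⟨Measure.measurable_dirac.comp (by fun_prop), fun _ _ _ => inferInstance⟩
    have hpick : Measurable fun q : (Fin N → ℝ) × Mem × ℕ => R.pickFun q.2.1 S q.1 :=
      (R.measurable_pickFun S).comp (f := fun q : (Fin N → ℝ) × Mem × ℕ => (q.2.1, q.1))
        (by fun_prop)
    let loop (E : Fin nlearn → Traj X A H) (z : ((Fin N → ℝ) × Mem × ℕ) ×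
        (Fin neval → Traj X A H)) (S' : Finset (Fin N)) : Measure (Outcome N Mem) :=
      oliveLoop P F R neval nlearn φ z.1.1 t S'
        (R.observe nlearn (R.observe neval z.1.2.1 z.2) E) (z.1.2.2 + neval + nlearn)
    let learn (f : Fin N) (h : Fin H) (z : ((Fin N → ℝ) × Mem × ℕ) ×
        (Fin neval → Traj X A H)) : Measure (Outcome N Mem) :=
      (Measure.pi fun _ : Fin nlearn => P.rollout (Rule.explore (F.greedy f) h) H).bind fun E =>
        loop E z (S.filter fun g => |F.learnError E g h| ≤ φ)
    let eval (f : Fin N) (z : ((Fin N → ℝ) × Mem × ℕ) × (Fin neval → Traj X A H)) :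
        Measure (Outcome N Mem) :=
      if ∑ h, F.evalError z.2 f h ≤ 5 * ε / 8 then
        Measure.dirac (Sum.inl (f, z.1.2.2 + neval))
      else learn f (R.pickLevel (R.observe neval z.1.2.1 z.2) (F.evalError z.2 f)) z
    have hobs : Measurable fun z : ((Fin N → ℝ) × Mem × ℕ) × (Fin neval → Traj X A H) =>
        R.observe neval z.1.2.1 z.2 :=
      (R.measurable_observe neval).comp
        (f := fun z : ((Fin N → ℝ) × Mem × ℕ) × (Fin neval → Traj X A H) => (z.1.2.1, z.2))
        (by fun_prop)
    have hloop : ∀ S', Measurable fun y : (((Fin N → ℝ) × Mem × ℕ) ×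
        (Fin neval → Traj X A H)) × (Fin nlearn → Traj X A H) => loop y.2 y.1 S' := by
      intro S'
      have hobs' : Measurable fun y : (((Fin N → ℝ) × Mem × ℕ) ×
          (Fin neval → Traj X A H)) × (Fin nlearn → Traj X A H) =>
          R.observe nlearn (R.observe neval y.1.1.2.1 y.1.2) y.2 :=
        (R.measurable_observe nlearn).comp ((hobs.comp measurable_fst).prodMk measurable_snd)
      exact (ih S').1.comp (f := fun y : (((Fin N → ℝ) × Mem × ℕ) ×
          (Fin neval → Traj X A H)) × (Fin nlearn → Traj X A H) =>
          (y.1.1.1, R.observe nlearn (R.observe neval y.1.1.2.1 y.1.2) y.2,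
            y.1.1.2.2 + neval + nlearn)) (Measurable.prodMk (by fun_prop)
          (Measurable.prodMk hobs' (by fun_prop)))
    have hfilter : ∀ h : Fin H, Measurable fun y : (((Fin N → ℝ) × Mem × ℕ) ×
        (Fin neval → Traj X A H)) × (Fin nlearn → Traj X A H) =>
        loop y.2 y.1 (S.filter fun g => |F.learnError y.2 g h| ≤ φ) := fun h =>
      measurable_of_countable_cases (ι := Finset (Fin N))
        (fun S' => measurable_snd (F.measurableSet_filter_learnError_eq nlearn h φ S S'))
        (g := fun S' y => loop y.2 y.1 S') hloop
    have hlearn : ∀ f h, Measurable (learn f h) := fun f h =>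
      measurable_bind_prodMk (g := fun y => loop y.2 y.1
        (S.filter fun g => |F.learnError y.2 g h| ≤ φ)) (hfilter h)
    have hploop : ∀ E z S', IsProbabilityMeasure (loop E z S') := fun E z S' => (ih S').2 _ _ _
    have hplearn : ∀ f h z, IsProbabilityMeasure (learn f h z) := fun f h z =>
      isProbabilityMeasure_bind_prodMk (g := fun y => loop y.2 y.1
        (S.filter fun g => |F.learnError y.2 g h| ≤ φ)) (hfilter h) (fun y => hploop y.2 y.1 _) z
    have hev : ∀ f, Measurable fun z : ((Fin N → ℝ) × Mem × ℕ) × (Fin neval → Traj X A H) =>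
        F.evalError z.2 f := fun f =>
      measurable_pi_iff.2 fun h => (F.measurable_evalError neval f h).comp measurable_snd
    have heval : ∀ f, Measurable (eval f) := fun f =>
      Measurable.ite (measurableSet_le (Finset.measurable_sum _ fun h _ =>
        (measurable_pi_apply h).comp (hev f)) measurable_const)
        (Measure.measurable_dirac.comp (by fun_prop))
        (measurable_of_countable_cases (g := learn f)
          (fun h => R.measurable_pickLevel.comp (hobs.prodMk (hev f)) (measurableSet_singleton h))
          (hlearn f))
    have hpeval : ∀ f z, IsProbabilityMeasure (eval f z) := by
      intro f z
      by_cases hz : ∑ h, F.evalError z.2 f h ≤ 5 * ε / 8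
      · simp only [eval, if_pos hz]
        infer_instance
      · simp only [eval, if_neg hz]
        exact hplearn _ _ _
    refine ⟨?_, fun v m e => isProbabilityMeasure_bind_prodMk
      (g := eval (R.pickFun m S v)) (heval _) (hpeval _) (v, m, e)⟩
    exact measurable_of_countable_cases (fun f => hpick (measurableSet_singleton f))
      (g := fun f q => (Measure.pi fun _ : Fin neval =>
        P.rollout (Rule.follow (F.greedy f)) H).bind fun D => eval f (q, D))
      fun f => measurable_bind_prodMk (heval f)

theorem measurable_oliveLoop (P : System X A) (F : QClass X A N) (R : Resolver X A H N ε Mem)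
    (neval nlearn : ℕ) (φ : ℝ) (t : ℕ) (S : Finset (Fin N)) :
    Measurable fun q : (Fin N → ℝ) × Mem × ℕ =>
      oliveLoop P F R neval nlearn φ q.1 t S q.2.1 q.2.2 :=
  (measurable_oliveLoop_and_isProbabilityMeasure P F R neval nlearn φ t S).1

instance isProbabilityMeasure_oliveLoop (P : System X A) (F : QClass X A N)
    (R : Resolver X A H N ε Mem) (neval nlearn : ℕ) (φ : ℝ) (v : Fin N → ℝ) (t : ℕ)
    (S : Finset (Fin N)) (m : Mem) (e : ℕ) :
    IsProbabilityMeasure (oliveLoop P F R neval nlearn φ v t S m e) :=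
  (measurable_oliveLoop_and_isProbabilityMeasure P F R neval nlearn φ t S).2 v m e

theorem measurable_oliveCall_and_isProbabilityMeasure (P : System X A) (F : QClass X A N) (hH : 0 < H)
    (R : Resolver X A H N ε Mem) (ζ δ : ℝ) (i : ℕ) :
    Measurable (oliveCall P F hH R ζ δ i) ∧
      ∀ m, IsProbabilityMeasure (oliveCall P F hH R ζ δ i m) := by
  let M := 2 ^ i
  let δ' := δ / (i * (i + 1))
  let loop (z : Mem × (Fin (nEst N ε δ') → Traj X A H)) : Measure (Outcome N Mem) :=
    oliveLoop P F R (nEval H M ζ ε δ') (nLearn (Fintype.card A) N H M ζ ε δ') (phi H M ε)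
      (F.empValue hH z.2) (maxIter H M ζ ε) Finset.univ (R.observe _ z.1 z.2) (nEst N ε δ')
  have hloop : Measurable loop :=
    (measurable_oliveLoop P F R _ _ _ _ _).comp (Measurable.prodMk
      ((F.measurable_empValue hH _).comp measurable_snd)
      (Measurable.prodMk (R.measurable_observe _) measurable_const))
  have hploop : ∀ z, IsProbabilityMeasure (loop z) := fun z =>
    isProbabilityMeasure_oliveLoop P F R _ _ _ _ _ _ _ _
  constructor
  · exact measurable_bind_prodMk (g := loop) hloop
  · exact isProbabilityMeasure_bind_prodMk (g := loop) hloop hploop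

instance isProbabilityMeasure_oliveCall (P : System X A) (F : QClass X A N) (hH : 0 < H)
    (R : Resolver X A H N ε Mem) (ζ δ : ℝ) (i : ℕ) (m : Mem) :
    IsProbabilityMeasure (oliveCall P F hH R ζ δ i m) :=
  (measurable_oliveCall_and_isProbabilityMeasure P F hH R ζ δ i).2 m

theorem measurable_guessRun_and_isProbabilityMeasure (P : System X A) (F : QClass X A N) (hH : 0 < H)
    (R : Resolver X A H N ε Mem) (ζ δ : ℝ) (k i : ℕ) :
    (Measurable fun q : Mem × ℕ => guessRun P F hH R ζ δ k i q.1 q.2) ∧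
      ∀ m e, IsProbabilityMeasure (guessRun P F hH R ζ δ k i m e) := by
  induction k generalizing i with
  | zero =>
    simp only [guessRun]
    exact ⟨Measure.measurable_dirac.comp (by fun_prop), fun _ _ => inferInstance⟩
  | succ k ih =>
    simp only [guessRun]
    have h1 : ∀ e : ℕ, Measurable (Sum.elim
        (fun o : Fin N × ℕ => (Measure.dirac (Sum.inl (o.1, e + o.2)) : Measure (Outcome N Mem)))
        (fun o : Mem × ℕ => guessRun P F hH R ζ δ k (i + 1) o.1 (e + o.2))) := fun e =>
      Measurable.sumElim (Measure.measurable_dirac.comp (by fun_prop)) 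
        ((ih (i + 1)).1.comp (f := fun o : Mem × ℕ => (o.1, e + o.2)) (by fun_prop))
    have h2 : ∀ (e : ℕ) o, IsProbabilityMeasure (Sum.elim
        (fun o : Fin N × ℕ => (Measure.dirac (Sum.inl (o.1, e + o.2)) : Measure (Outcome N Mem)))
        (fun o : Mem × ℕ => guessRun P F hH R ζ δ k (i + 1) o.1 (e + o.2)) o) := by
      rintro e (o | o)
      · simp only [Sum.elim_inl]
        infer_instance
      · exact (ih (i + 1)).2 _ _
    refine ⟨?_, fun m e => isProbabilityMeasure_bind (h1 e).aemeasurable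
      (Filter.Eventually.of_forall (h2 e))⟩
    -- The continuation has the count `e` as a parameter; with `e` fixed, one measurable function is
    -- bound to varying measures.
    refine measurable_of_countable_cases (s := fun q : Mem × ℕ => q.2)
      (fun e => measurable_snd (measurableSet_singleton e)) (g := fun e q =>
        (oliveCall P F hH R ζ δ i q.1).bind (Sum.elim
          (fun o : Fin N × ℕ => (Measure.dirac (Sum.inl (o.1, e + o.2)) : Measure (Outcome N Mem)))
          (fun o : Mem × ℕ => guessRun P F hH R ζ δ k (i + 1) o.1 (e + o.2)))) fun e => ?_
    exact (Measure.measurable_bind' (h1 e)).comp ((measurable_oliveCall_and_isProbabilityMeasure P F hH R ζ δ i).1.comp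
      measurable_fst)

instance isProbabilityMeasure_guessRun (P : System X A) (F : QClass X A N) (hH : 0 < H)
    (R : Resolver X A H N ε Mem) (ζ δ : ℝ) (k i : ℕ) (m : Mem) (e : ℕ) :
    IsProbabilityMeasure (guessRun P F hH R ζ δ k i m e) :=
  (measurable_guessRun_and_isProbabilityMeasure P F hH R ζ δ k i).2 m e

end Measurability

end CDP

/-! ### The determinant potential. -/

section Potential

open Matrix

variable {M : ℕ}

/-- The regularized sum of the outer products of a list of vectors. -/
def gramSum (c : ℝ) (l : List (Fin M → ℝ)) : Matrix (Fin M) (Fin M) ℝ :=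
  (l.map fun v => vecMulVec v v).sum + c • (1 : Matrix (Fin M) (Fin M) ℝ)

theorem gramSum_cons (c : ℝ) (v : Fin M → ℝ) (l : List (Fin M → ℝ)) :
    gramSum c (v :: l) = vecMulVec v v + gramSum c l := by
  simp [gramSum, add_assoc]

theorem posDef_gramSum {c : ℝ} (hc : 0 < c) (l : List (Fin M → ℝ)) : (gramSum c l).PosDef := by
  induction l with
  | nil => simpa [gramSum] using PosDef.one.smul hc
  | cons v l ih =>
    rw [gramSum_cons]
    exact PosDef.posSemidef_add (by simpa using posSemidef_vecMulVec_self_star v) ih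

theorem dotProduct_gramSum_mulVec (c : ℝ) (l : List (Fin M → ℝ)) (x : Fin M → ℝ) :
    x ⬝ᵥ (gramSum c l *ᵥ x) = (l.map fun v => (v ⬝ᵥ x) ^ 2).sum + c * (x ⬝ᵥ x) := by
  induction l with
  | nil => simp [gramSum, smul_mulVec]
  | cons v l ih =>
    rw [gramSum_cons, add_mulVec, dotProduct_add, ih, vecMulVec_mulVec]
    simp [dotProduct_comm x v]
    ring

theorem trace_gramSum (c : ℝ) (l : List (Fin M → ℝ)) :
    (gramSum c l).trace = (l.map fun v => v ⬝ᵥ v).sum + c * M := by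
  induction l with
  | nil => simp [gramSum]
  | cons v l ih =>
    rw [gramSum_cons, trace_add, ih, trace_vecMulVec]
    simp
    ring

theorem det_gramSum_cons {c : ℝ} (hc : 0 < c) (v : Fin M → ℝ) (l : List (Fin M → ℝ)) :
    (gramSum c (v :: l)).det = (gramSum c l).det * (1 + v ⬝ᵥ ((gramSum c l)⁻¹ *ᵥ v)) := by
  have hdet : IsUnit (gramSum c l).det := (posDef_gramSum hc l).det_pos.ne'.isUnit
  have h := det_add_replicateCol_mul_replicateRow (ι := Unit) hdet v v
  rw [gramSum_cons, add_comm, vecMulVec_eq Unit, h]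
  congr 1
  rw [det_unique]
  simp [Matrix.mul_assoc, Matrix.mul_apply, dotProduct, mulVec, replicateCol, replicateRow]

/-- Cauchy–Schwarz for the inner product of `B`, through the discriminant of the nonnegative
quadratic form at `x - s B⁻¹ v`. -/
theorem Matrix.PosDef.sq_dotProduct_le {B : Matrix (Fin M) (Fin M) ℝ} (hB : B.PosDef)
    (v x : Fin M → ℝ) : (v ⬝ᵥ x) ^ 2 ≤ (v ⬝ᵥ (B⁻¹ *ᵥ v)) * (x ⬝ᵥ (B *ᵥ x)) := by
  have hdet : IsUnit B.det := hB.det_pos.ne'.isUnit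
  have hBt : Bᵀ = B := by simpa using hB.1.eq
  set w := B⁻¹ *ᵥ v with hw
  have hBw : B *ᵥ w = v := by rw [hw, mulVec_mulVec, mul_nonsing_inv _ hdet, one_mulVec]
  have hxw : w ⬝ᵥ (B *ᵥ x) = v ⬝ᵥ x := by
    rw [dotProduct_mulVec, ← mulVec_transpose, hBt, hBw]
  have hq : ∀ s : ℝ, 0 ≤ (v ⬝ᵥ w) * (s * s) + (-2 * (v ⬝ᵥ x)) * s + x ⬝ᵥ (B *ᵥ x) := by
    intro s
    have h := hB.posSemidef.dotProduct_mulVec_nonneg (x - s • w)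
    simp only [star_trivial, mulVec_sub, mulVec_smul, hBw, sub_dotProduct, dotProduct_sub,
      smul_dotProduct, dotProduct_smul, hxw, smul_eq_mul] at h
    rw [dotProduct_comm x v, dotProduct_comm w v] at h
    linarith
  have := discrim_le_zero hq
  unfold discrim at this
  nlinarith

/-- Each eigenvalue is at most the sum of all. Compared with the arithmetic-geometric mean
inequality this loses a factor `M ^ M`, which costs only a logarithm later. -/
theorem Matrix.PosSemidef.det_le_trace_pow {B : Matrix (Fin M) (Fin M) ℝ} (hB : B.PosSemidef) :
    B.det ≤ B.trace ^ M := by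
  rw [hB.1.det_eq_prod_eigenvalues, hB.1.trace_eq_sum_eigenvalues]
  calc _ ≤ ∏ _i : Fin M, ∑ j, hB.1.eigenvalues j :=
        Finset.prod_le_prod (fun i _ => hB.eigenvalues_nonneg i) fun i _ =>
          Finset.single_le_sum (fun j _ => hB.eigenvalues_nonneg j) (Finset.mem_univ i)
    _ = _ := by simp

/-- Vectors `p.1` that are nearly orthogonal to the test vectors `q.2` of later elements `q`, but
not to their own test vector, are few (the list has its latest element first). -/
theorem two_pow_length_le_of_pairwise {a b η r : ℝ} (hb : 0 < b) (hη : 0 < η)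
    (l : List ((Fin M → ℝ) × (Fin M → ℝ)))
    (hν : ∀ p ∈ l, p.1 ⬝ᵥ p.1 ≤ a ^ 2) (hξ : ∀ p ∈ l, p.2 ⬝ᵥ p.2 ≤ b ^ 2)
    (hbig : ∀ p ∈ l, r * η ^ 2 ≤ (p.1 ⬝ᵥ p.2) ^ 2)
    (hsmall : l.Pairwise fun p q => (q.1 ⬝ᵥ p.2) ^ 2 ≤ η ^ 2) (hlen : (l.length : ℝ) ≤ r) :
    (2 : ℝ) ^ l.length ≤ (l.length * (a * b / η) ^ 2 + M) ^ M := by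
  -- With this `c` the regularizer adds at most `η ^ 2` to the quadratic form at a test vector, as
  -- much as one more earlier vector would.
  set c : ℝ := η ^ 2 / b ^ 2 with hc
  have hc0 : 0 < c := by positivity
  have hlow : c ^ M * 2 ^ l.length ≤ (gramSum c (l.map Prod.fst)).det := by
    clear hν
    induction l with
    | nil => simp [gramSum]
    | cons p l ih =>
      simp only [List.mem_cons, forall_eq_or_imp, List.pairwise_cons, List.length_cons,
        Nat.cast_add, Nat.cast_one] at hξ hbig hsmall hlen
      have ih' := ih hξ.2 hbig.2 hsmall.2 (by linarith)
      rw [List.map_cons, det_gramSum_cons hc0, List.length_cons, pow_succ, ← mul_assoc]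
      have hpd := posDef_gramSum hc0 (l.map Prod.fst)
      have h1 := hpd.sq_dotProduct_le p.1 p.2
      have h2 : p.2 ⬝ᵥ (gramSum c (l.map Prod.fst) *ᵥ p.2) ≤ (l.length + 1) * η ^ 2 := by
        rw [dotProduct_gramSum_mulVec, List.map_map]
        have h3 : (l.map ((fun v => (v ⬝ᵥ p.2) ^ 2) ∘ Prod.fst)).sum ≤ l.length * η ^ 2 := by
          have := List.sum_le_card_nsmul (l.map ((fun v => (v ⬝ᵥ p.2) ^ 2) ∘ Prod.fst)) (η ^ 2)
            (by
              intro y hy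
              obtain ⟨q, hq, rfl⟩ := List.mem_map.1 hy
              exact hsmall.1 q hq)
          simpa using this
        have h4 : c * (p.2 ⬝ᵥ p.2) ≤ η ^ 2 := by
          calc c * (p.2 ⬝ᵥ p.2) ≤ c * b ^ 2 := by gcongr; exact hξ.1
            _ = η ^ 2 := by rw [hc]; field_simp
        linarith
      -- By `h1` and `h2`, a value below `1` would force `r < l.length + 1`, against `hlen`. The
      -- determinant lemma then gives the factor `2`.
      have h5 : 1 ≤ p.1 ⬝ᵥ ((gramSum c (l.map Prod.fst))⁻¹ *ᵥ p.1) := by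
        by_contra! hlt
        have h6 : 0 ≤ p.1 ⬝ᵥ ((gramSum c (l.map Prod.fst))⁻¹ *ᵥ p.1) := by
          simpa using hpd.inv.posSemidef.dotProduct_mulVec_nonneg p.1
        have h7 : 0 < ((l.length : ℝ) + 1) * η ^ 2 := by positivity
        have h8 : r * η ^ 2 < (l.length + 1) * η ^ 2 :=
          calc r * η ^ 2 ≤ _ := hbig.1
            _ ≤ _ := h1
            _ ≤ _ * ((l.length + 1) * η ^ 2) := mul_le_mul_of_nonneg_left h2 h6
            _ < 1 * ((l.length + 1) * η ^ 2) := mul_lt_mul_of_pos_right hlt h7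
            _ = _ := one_mul _
        have h9 := lt_of_mul_lt_mul_right h8 (by positivity)
        linarith
      exact mul_le_mul ih' (by linarith) (by norm_num) hpd.det_pos.le
  have hup := (posDef_gramSum hc0 (l.map Prod.fst)).posSemidef.det_le_trace_pow
  have htr : (gramSum c (l.map Prod.fst)).trace ≤ c * (l.length * (a * b / η) ^ 2 + M) := by
    rw [trace_gramSum, List.map_map]
    have h3 : (l.map ((fun v => v ⬝ᵥ v) ∘ Prod.fst)).sum ≤ l.length * a ^ 2 := by
      have := List.sum_le_card_nsmul (l.map ((fun v => v ⬝ᵥ v) ∘ Prod.fst)) (a ^ 2)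
        (by
          intro y hy
          obtain ⟨q, hq, rfl⟩ := List.mem_map.1 hy
          exact hν q hq)
      simpa using this
    have h4 : c * (l.length * (a * b / η) ^ 2 + M) = l.length * a ^ 2 + c * M := by
      rw [hc]
      field_simp
    linarith
  have htr0 : 0 ≤ (gramSum c (l.map Prod.fst)).trace :=
    (posDef_gramSum hc0 _).posSemidef.trace_nonneg
  have h := (hlow.trans hup).trans (pow_le_pow_left₀ htr0 htr M)
  rw [mul_pow] at h
  exact le_of_mul_le_mul_left h (by positivity)

end Potential

namespace CDP

/-! ### OLIVE and GuessM when the estimates are accurate. -/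

section Analysis

variable {X A : Type*} [MeasurableSpace X] [MeasurableSpace A] {N H : ℕ}

/-- A list of eliminations (latest first), each a function with a large Bellman error on its own
roll-in that has survived the earlier eliminations at the same level. -/
def QClass.Consistent (F : QClass X A N) (P : System X A) (ε φ : ℝ)
    (l : List (Fin N × Fin H)) : Prop :=
  (∀ p ∈ l, ε / (2 * H) ≤ F.bellmanError P p.1 (F.greedy p.1) p.2) ∧
    l.Pairwise fun p q => q.2 = p.2 → |F.bellmanError P p.1 (F.greedy q.1) p.2| ≤ 2 * φ

/-- The outcomes that return a function in `G` or else, if this is allowed, fail, and use at most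
`B` episodes. -/
def goodOutcome (Mem : Type*) (G : Set (Fin N)) (fail : Prop) (B : ℕ) : Set (Outcome N Mem) :=
  {o | Sum.elim (fun a => a.1 ∈ G ∧ a.2 ≤ B) (fun a => fail ∧ a.2 ≤ B) o}

theorem inl_mem_goodOutcome {Mem : Type*} {G : Set (Fin N)} {fail : Prop} {B : ℕ} {f : Fin N}
    {e : ℕ} : (Sum.inl (f, e) : Outcome N Mem) ∈ goodOutcome Mem G fail B ↔ f ∈ G ∧ e ≤ B :=
  Iff.rfl

theorem inr_mem_goodOutcome {Mem : Type*} {G : Set (Fin N)} {fail : Prop} {B : ℕ} {m : Mem}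
    {e : ℕ} : (Sum.inr (m, e) : Outcome N Mem) ∈ goodOutcome Mem G fail B ↔ fail ∧ e ≤ B :=
  Iff.rfl

theorem measurableSet_goodOutcome {Mem : Type*} [MeasurableSpace Mem] (G : Set (Fin N))
    (fail : Prop) (B : ℕ) : MeasurableSet (goodOutcome Mem G fail B) := by
  refine measurableSet_sum_iff.2 ⟨MeasurableSet.of_discrete, ?_⟩
  exact measurable_snd (MeasurableSet.of_discrete (s := {e : ℕ | fail ∧ e ≤ B}))

theorem dirac_compl_eq_zero {α : Type*} [MeasurableSpace α] {s : Set α} (hs : MeasurableSet s)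
    {a : α} (ha : a ∈ s) : Measure.dirac a sᶜ = 0 := by
  rw [Measure.dirac_apply' _ hs.compl]
  simp [ha]

variable [DiscreteMeasurableSpace A] [Fintype A]

/-- The policies of the class whose value is within `ε` of the optimum. -/
def QClass.nearOpt (F : QClass X A N) (P : System X A) (H : ℕ) (ε : ℝ) : Set (Fin N) :=
  {f | F.optValue P H - ε ≤ P.value H (F.greedy f)}

theorem QClass.exists_isValid_optValue_eq (F : QClass X A N) {P : System X A}
    (hP : P.RewardsBounded H) (hH : 0 < H) (hv : ∃ f, F.IsValid P H f) :
    ∃ f, F.IsValid P H f ∧ F.optValue P H = F.predValue P f := by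
  have hfin : {v | ∃ f, F.IsValid P H f ∧ v = P.value H (F.greedy f)}.Finite := by
    refine (Set.finite_range fun f => P.value H (F.greedy f)).subset ?_
    rintro v ⟨f, _, rfl⟩
    exact ⟨f, rfl⟩
  obtain ⟨f₀, hf₀⟩ := hv
  obtain ⟨f, hf, hval⟩ := Set.Nonempty.csSup_mem
    (s := {v | ∃ f, F.IsValid P H f ∧ v = P.value H (F.greedy f)}) ⟨_, f₀, hf₀, rfl⟩ hfin
  exact ⟨f, hf, hval.trans (hf.value_eq hP hH)⟩

/-- The loss `ε` is made up of `5ε/8` from the stopping threshold, `ε/8` from the evaluation errors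
summed over the levels, and `ε/8` for each of the estimates `v f` and `v g`. Optimism enters through
`v g ≤ v f`. -/
theorem QClass.mem_nearOpt (F : QClass X A N) {P : System X A} (hP : P.RewardsBounded H)
    (hH : 0 < H) {ε : ℝ} {v : Fin N → ℝ} {d : Fin H → ℝ} {f g : Fin N}
    (hg : F.optValue P H = F.predValue P g) (hv : ∀ f, |v f - F.predValue P f| ≤ ε / 8)
    (hd : ∀ h, |d h - F.bellmanError P f (F.greedy f) h| ≤ ε / (8 * H)) (hfg : v g ≤ v f)
    (hsum : ∑ h, d h ≤ 5 * ε / 8) : f ∈ F.nearOpt P H ε := by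
  have h1 := F.predValue_sub_value hP hH f
  have h2 : ∑ h, F.bellmanError P f (F.greedy f) h ≤ ∑ h, (d h + ε / (8 * H)) :=
    Finset.sum_le_sum fun h _ => by linarith [(abs_le.1 (hd h)).1]
  have hH' : (0 : ℝ) < H := by exact_mod_cast hH
  have h3 : ∑ _h : Fin H, ε / (8 * H) = ε / 8 := by
    simp
    field_simp
  rw [Finset.sum_add_distrib, h3] at h2
  change F.optValue P H - ε ≤ _
  linarith [(abs_le.1 (hv f)).2, (abs_le.1 (hv g)).1]

variable [Nonempty A] {ε : ℝ} {Mem : Type*} [MeasurableSpace Mem]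

/-- Here `l` records the past eliminations. The invariant is that `l` is consistent, that all
survivors have Bellman error at most `2φ` (threshold plus estimation error) on the recorded
roll-ins, and that the valid `fs` survives. Each iteration risks `η₁` in evaluation and `η₂` in
learning. `hT` matters only when the iterations run out, for then `l` has length `T`. -/
theorem oliveLoop_compl_goodOutcome_le {P : System X A} {F : QClass X A N}
    (R : Resolver X A H N ε Mem) (hP : P.RewardsBounded H) (hH : 0 < H) {neval nlearn : ℕ}
    {φ : ℝ} {v : Fin N → ℝ} {η₁ η₂ : ENNReal}
    (heval : ∀ f : Fin N, (Measure.pi fun _ : Fin neval => P.rollout (Rule.follow (F.greedy f)) H)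
      {D | ∃ h : Fin H, ε / (8 * H) < |F.evalError D f h - F.bellmanError P f (F.greedy f) h|} ≤ η₁)
    (hlearn : ∀ (f : Fin N) (h : Fin H), (Measure.pi fun _ : Fin nlearn =>
      P.rollout (Rule.explore (F.greedy f) h) H)
      {E | ∃ g, φ < |F.learnError E g h - F.bellmanError P g (F.greedy f) h|} ≤ η₂)
    (hv : ∀ f, |v f - F.predValue P f| ≤ ε / 8) {fs : Fin N} (hfs : F.IsValid P H fs)
    (hopt : F.optValue P H = F.predValue P fs) {fail : Prop} {T B : ℕ}
    (hT : ¬fail → ∀ l : List (Fin N × Fin H), F.Consistent P ε φ l → l.length < T)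
    (t : ℕ) (S : Finset (Fin N)) (l : List (Fin N × Fin H)) (m : Mem) (e : ℕ)
    (hl : F.Consistent P ε φ l)
    (hS : ∀ g ∈ S, ∀ q ∈ l, |F.bellmanError P g (F.greedy q.1) q.2| ≤ 2 * φ) (hfsS : fs ∈ S)
    (hlen : l.length + t = T) (he : e + t * (neval + nlearn) ≤ B) :
    oliveLoop P F R neval nlearn φ v t S m e (goodOutcome Mem (F.nearOpt P H ε) fail B)ᶜ ≤
      t * (η₁ + η₂) := by
  have hgood := measurableSet_goodOutcome (Mem := Mem) (F.nearOpt P H ε) fail B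
  induction t generalizing S l m e with
  | zero =>
    simp only [oliveLoop]
    rw [dirac_compl_eq_zero hgood]
    · simp
    · refine inr_mem_goodOutcome.2 ⟨?_, by omega⟩
      by_contra hfail
      have := hT hfail l hl
      omega
  | succ t ih =>
    have hSne : S.Nonempty := ⟨fs, hfsS⟩
    simp only [oliveLoop]
    rw [if_neg hSne.ne_empty]
    set f := R.pickFun m S v with hf
    have hfS : f ∈ S := R.pickFun_mem m S v hSne
    have hsplit : ((t + 1 : ℕ) : ENNReal) * (η₁ + η₂) = η₁ + (η₂ + t * (η₁ + η₂)) := by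
      push_cast
      ring
    have he' : e + neval + nlearn + t * (neval + nlearn) ≤ B := by
      refine le_trans (le_of_eq ?_) he
      ring
    rw [hsplit]
    refine bind_apply_le_add hgood.compl (fun D => ?_) (heval f) fun D hD => ?_
    · split_ifs
      · exact prob_le_one
      · exact bind_apply_le_one hgood.compl fun E => prob_le_one
    have hD' : ∀ h, |F.evalError D f h - F.bellmanError P f (F.greedy f) h| ≤ ε / (8 * H) := by
      simpa using hD
    split_ifs with hsum
    · rw [dirac_compl_eq_zero hgood]
      · exact zero_le
      · exact inl_mem_goodOutcome.2 ⟨F.mem_nearOpt hP hH hopt hv hD'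
          (R.pickFun_max m S v fs hfsS) hsum, by omega⟩
    set m₁ := R.observe neval m D
    set h := R.pickLevel m₁ (F.evalError D f) with hh
    -- The picked level has estimate at least `5ε/(8H)`, of which at most `ε/(8H)` is estimation
    -- error.
    have hlarge : ε / (2 * H) ≤ F.bellmanError P f (F.greedy f) h := by
      have h1 := R.pickLevel_large m₁ (F.evalError D f) (not_le.1 hsum)
      have h2 := (abs_le.1 (hD' h)).2
      have h3 : 5 * ε / (8 * H) - ε / (8 * H) = ε / (2 * H) := by
        have hH' : (H : ℝ) ≠ 0 := by exact_mod_cast hH.ne'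
        field_simp
        ring
      rw [← hh] at h1
      linarith
    refine bind_apply_le_add hgood.compl (fun E => prob_le_one) (hlearn f h) fun E hE => ?_
    have hE' : ∀ g, |F.learnError E g h - F.bellmanError P g (F.greedy f) h| ≤ φ := by
      simpa using hE
    refine ih _ ((f, h) :: l) _ _ ⟨?_, ?_⟩ ?_ ?_ ?_ he'
    · intro p hp
      rcases List.mem_cons.1 hp with rfl | hp
      · exact hlarge
      · exact hl.1 p hp
    · refine List.pairwise_cons.2 ⟨fun q hq hqh => ?_, hl.2⟩
      have := hS f hfS q hq
      rwa [hqh] at this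
    · intro g hg q hq
      rw [Finset.mem_filter] at hg
      rcases List.mem_cons.1 hq with rfl | hq
      · have h1 := abs_le.1 (hE' g)
        have h2 := abs_le.1 hg.2
        exact abs_le.2 ⟨by linarith [h1.2, h2.1], by linarith [h1.1, h2.2]⟩
      · exact hS g hg.1 q hq
    -- The Bellman error of `fs` vanishes, so its estimate is within `φ` of zero.
    · refine Finset.mem_filter.2 ⟨hfsS, ?_⟩
      have := hE' fs
      rwa [hfs f h, sub_zero] at this
    · rw [List.length_cons]
      omega

/-- Call `is` is the one that is not allowed to fail. By `i + k = is + 1` the budget of calls ends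
exactly with it, so the case `k = 0` does not occur. -/
theorem guessRun_compl_le {P : System X A} {F : QClass X A N} (hH : 0 < H)
    (R : Resolver X A H N ε Mem) {ζ δ : ℝ} {is c B : ℕ} {d : ℕ → ENNReal} {G : Set (Fin N)}
    (hcall : ∀ i, 1 ≤ i → i ≤ is → ∀ m, oliveCall P F hH R ζ δ i m
      (goodOutcome Mem G (i < is) c)ᶜ ≤ d i)
    (k i : ℕ) (m : Mem) (e : ℕ) (hi : 1 ≤ i) (his : i ≤ is) (hk : i + k = is + 1)
    (he : e + k * c ≤ B) :
    guessRun P F hH R ζ δ k i m e (goodOutcome Mem G False B)ᶜ ≤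
      ∑ j ∈ Finset.Ico i (is + 1), d j := by
  have hgood := measurableSet_goodOutcome (Mem := Mem) G False B
  induction k generalizing i m e with
  | zero => omega
  | succ k ih =>
    simp only [guessRun]
    rw [Finset.sum_eq_sum_Ico_succ_bot (by omega)]
    have hkc : (k + 1) * c = c + k * c := by ring
    refine bind_apply_le_add hgood.compl ?_ (hcall i hi his m) ?_
    · rintro (o | o)
      · simp only [Sum.elim_inl]
        exact prob_le_one
      · simp only [Sum.elim_inr]
        exact prob_le_one
    · rintro (⟨f, n⟩ | ⟨m', n⟩) ho
      · obtain ⟨h1, h2⟩ := inl_mem_goodOutcome.1 (not_not.1 ho)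
        simp only [Sum.elim_inl]
        rw [dirac_compl_eq_zero hgood]
        · exact zero_le
        · refine inl_mem_goodOutcome.2 ⟨h1, ?_⟩
          have := Nat.zero_le (k * c)
          omega
      · obtain ⟨h1, h2⟩ := inr_mem_goodOutcome.1 (not_not.1 ho)
        simp only [Sum.elim_inr]
        exact ih (i + 1) m' (e + n) (by omega) (by omega) (by omega) (by omega)

end Analysis

end CDP

namespace CDP

/-! ### Numerical facts about the parameters. -/

section Parameters

variable {H M N : ℕ} {ζ ε δ : ℝ}

theorem log_sqrt_le_iterLog (hM : 0 < M) (hε : 0 < ε) (hζ : ε ≤ H * ζ) :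
    Real.log (6 * √M) ≤ iterLog H M ζ ε := by
  have hM' : (0 : ℝ) < √M := Real.sqrt_pos.2 (by exact_mod_cast hM)
  refine Real.log_le_log (by positivity) ?_
  rw [le_div_iff₀ hε]
  nlinarith

theorem one_le_iterLog (hM : 0 < M) (hε : 0 < ε) (hζ : ε ≤ H * ζ) :
    1 ≤ iterLog H M ζ ε := by
  refine le_trans ?_ (log_sqrt_le_iterLog hM hε hζ)
  have hM' : (1 : ℝ) ≤ √M := Real.one_le_sqrt.2 (by exact_mod_cast hM)
  rw [Real.le_log_iff_exp_le (by positivity)]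
  linarith [Real.exp_one_lt_d9]

theorem half_le_log_five_thirds : (1 : ℝ) / 2 ≤ Real.log (5 / 3) := by
  have h : Real.log ((5 / 3 : ℝ) ^ 2) = 2 * Real.log (5 / 3) := by
    rw [Real.log_pow]
    norm_num
  have h2 : (1 : ℝ) ≤ Real.log ((5 / 3 : ℝ) ^ 2) := by
    rw [Real.le_log_iff_exp_le (by positivity)]
    linarith [Real.exp_one_lt_d9]
  linarith

theorem maxIter_le (hH : 0 < H) (hM : 0 < M) (hε : 0 < ε) (hζ : ε ≤ H * ζ) :
    (maxIter H M ζ ε : ℝ) ≤ 2 * (H * M * iterLog H M ζ ε) := by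
  have hL := one_le_iterLog hM hε hζ
  refine (Nat.floor_le (by have := half_le_log_five_thirds; positivity)).trans ?_
  rw [div_le_iff₀ (by linarith [half_le_log_five_thirds])]
  have : 0 ≤ (H * M * iterLog H M ζ ε : ℝ) := by positivity
  nlinarith [half_le_log_five_thirds]

/-- Since `6√M ≥ 12 > e²`, the logarithm in the cap is at least `2`, while `log (5/3) ≤ 1`. This
leaves room for `2M` eliminations at each of the `H` levels. -/
theorem two_mul_le_maxIter (hH : 0 < H) (hM : 4 ≤ M) (hε : 0 < ε) (hζ : ε ≤ H * ζ) :
    2 * (H * M) ≤ maxIter H M ζ ε := by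
  have hM' : (2 : ℝ) ≤ √M := Real.le_sqrt_of_sq_le (by norm_num; exact_mod_cast hM)
  have hL : 2 ≤ iterLog H M ζ ε := by
    refine le_trans ?_ (log_sqrt_le_iterLog (by omega) hε hζ)
    rw [Real.le_log_iff_exp_le (by positivity)]
    have h1 : Real.exp 2 = Real.exp 1 * Real.exp 1 := by
      rw [← Real.exp_add]
      norm_num
    nlinarith [Real.exp_one_lt_d9, Real.exp_pos 1]
  have h2 : Real.log (5 / 3) ≤ 1 := by
    have := Real.log_le_sub_one_of_pos (show (0 : ℝ) < 5 / 3 by norm_num)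
    linarith
  refine Nat.le_floor ?_
  rw [le_div_iff₀ (by linarith [half_le_log_five_thirds])]
  push_cast
  have h3 : (0 : ℝ) ≤ H * M := by positivity
  calc 2 * ((H : ℝ) * M) * Real.log (5 / 3) ≤ 2 * (H * M) * 1 := by gcongr
    _ = H * M * 2 := by ring
    _ ≤ _ := by gcongr

theorem two_mul_exp_neg_le {x c : ℝ} (hx : 0 < x) (hc : Real.log x ≤ c) :
    2 * Real.exp (-c) ≤ 2 / x := by
  have h1 : Real.exp (-c) ≤ Real.exp (-Real.log x) := Real.exp_le_exp.2 (by linarith)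
  rw [Real.exp_neg (Real.log x), Real.exp_log hx] at h1
  rw [div_eq_mul_inv]
  linarith

end Parameters

theorem measure_exists_fin_le {Ω : Type*} [MeasurableSpace Ω] {μ : Measure Ω} {n : ℕ}
    {p : Ω → Fin n → Prop} {r : ℝ} (h : ∀ g, μ {D | p D g} ≤ ENNReal.ofReal r) :
    μ {D | ∃ g, p D g} ≤ ENNReal.ofReal (n * r) := by
  have h1 : {D | ∃ g, p D g} = ⋃ g, {D | p D g} := by
    ext D
    simp
  rw [h1, ENNReal.ofReal_mul (by positivity), ENNReal.ofReal_natCast]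
  refine (measure_iUnion_fintype_le _ _).trans ((Finset.sum_le_sum fun g _ => h g).trans ?_)
  simp

/-! ### Sample sizes and the failure probability of one call. -/

section Estimation

variable {X A : Type*} [MeasurableSpace X] [MeasurableSpace A] [DiscreteMeasurableSpace A]
  [Fintype A] {N H : ℕ} {ζ ε δ : ℝ}

/-- The first context has law `P.init` under every rule, so the first contexts are i.i.d. although
the episodes need not be identically distributed. -/
theorem pi_empValue_gt_le (F : QClass X A N) (P : System X A) (hH : 0 < H) (hN : 0 < N)
    (hε : 0 < ε) (hδ : 0 < δ) (hδ1 : δ < 1) (β : ℕ → Rule X A) :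
    (Measure.pi fun j : Fin (nEst N ε δ) => P.rollout (β j) H)
      {D | ∃ f, ε / 8 < |F.empValue hH D f - F.predValue P f|} ≤ ENNReal.ofReal (δ / 3) := by
  set n := nEst N ε δ with hn
  have hN' : (1 : ℝ) ≤ N := by exact_mod_cast hN
  have hx : 1 < 6 * (N : ℝ) / δ := by
    rw [one_lt_div hδ]
    linarith
  have hn0 : 0 < n := Nat.ceil_pos.2 (mul_pos (by positivity) (Real.log_pos hx))
  have hnle : 32 / ε ^ 2 * Real.log (6 * N / δ) ≤ n := Nat.le_ceil _
  have hmap : ∀ j : Fin n, (P.rollout (β j) H).map (fun τ => ctx τ ⟨0, hH⟩) = P.init := by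
    intro j
    exact P.map_ctx_zero (β j) hH
  have hpi : (Measure.pi fun j : Fin n => P.rollout (β j) H).map
      (fun D j => ctx (D j) ⟨0, hH⟩) = Measure.pi fun _ : Fin n => P.init := by
    have := Measure.pi_map_pi (μ := fun j : Fin n => P.rollout (β j) H)
      (f := fun _ τ => ctx τ ⟨0, hH⟩) (fun j => (measurable_ctx _).aemeasurable)
    rw [this]
    simp_rw [hmap]
  have hr : (N : ℝ) * (2 / (6 * N / δ)) = δ / 3 := by
    field_simp
    norm_num
  rw [← hr]
  refine measure_exists_fin_le fun f => ?_
  have hm : Measurable fun x => F.val f x ((F.greedy f).1 x) :=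
    F.measurable_val_comp f measurable_id (F.greedy f).2
  have hms : MeasurableSet {c : Fin n → X |
      ε / 8 < |(∑ j, F.val f (c j) ((F.greedy f).1 (c j))) / n - F.predValue P f|} :=
    measurableSet_lt measurable_const
      (((Finset.measurable_sum _ fun j _ => hm.comp (measurable_pi_apply j)).div_const _).sub_const
        _).abs
  have hmeas : Measurable fun (D : Fin n → Traj X A H) j => ctx (D j) ⟨0, hH⟩ :=
    measurable_pi_iff.2 fun j => (measurable_ctx _).comp (measurable_pi_apply j)
  have h1 := Measure.map_apply (μ := Measure.pi fun j : Fin n => P.rollout (β j) H) hmeas hms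
  rw [hpi] at h1
  refine (le_of_eq h1.symm).trans ?_
  refine (pi_abs_avg_sub_integral_gt_le_of_mem_Icc (μ := P.init) hm hn0 zero_lt_one
    (by positivity) (Filter.Eventually.of_forall fun x => F.val_mem _ _ _)).trans ?_
  refine ENNReal.ofReal_le_ofReal (two_mul_exp_neg_le (by linarith) ?_)
  have h2 : Real.log (6 * N / δ) = ε ^ 2 / 32 * (32 / ε ^ 2 * Real.log (6 * N / δ)) := by
    field_simp
  rw [h2]
  calc _ ≤ ε ^ 2 / 32 * n := by gcongr
    _ = _ := by ring

/-- The residuals lie in an interval of length `3`, so the Hoeffding exponent at deviation `ε/(8H)`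
is `n ε² / (288 H²)`. -/
theorem pi_evalError_gt_le (F : QClass X A N) {P : System X A} (hP : P.RewardsBounded H)
    {M : ℕ} (hM : 0 < M) (hH : 0 < H) (hε : 0 < ε) (hζ : ε ≤ H * ζ) (hδ : 0 < δ) (hδ1 : δ < 1)
    (f : Fin N) :
    (Measure.pi fun _ : Fin (nEval H M ζ ε δ) => P.rollout (Rule.follow (F.greedy f)) H)
      {D | ∃ h : Fin H, ε / (8 * H) < |F.evalError D f h - F.bellmanError P f (F.greedy f) h|} ≤
      ENNReal.ofReal (δ / (6 * (H * M * iterLog H M ζ ε))) := by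
  set n := nEval H M ζ ε δ with hn
  have hL := one_le_iterLog hM hε hζ
  set L := iterLog H M ζ ε with hLdef
  have hH' : (1 : ℝ) ≤ H := by exact_mod_cast hH
  have hM' : (1 : ℝ) ≤ M := by exact_mod_cast hM
  have hx : 1 < 12 * (H : ℝ) ^ 2 * M * L / δ := by
    rw [one_lt_div hδ]
    have : (1 : ℝ) ≤ H ^ 2 * M * L :=
      one_le_mul_of_one_le_of_one_le (one_le_mul_of_one_le_of_one_le (one_le_pow₀ hH') hM') hL
    linarith
  have hn0 : 0 < n := Nat.ceil_pos.2 (mul_pos (by positivity) (Real.log_pos hx))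
  have hnle : 288 * H ^ 2 / ε ^ 2 * Real.log (12 * H ^ 2 * M * L / δ) ≤ n := Nat.le_ceil _
  have hr : (H : ℝ) * (2 / (12 * H ^ 2 * M * L / δ)) = δ / (6 * (H * M * L)) := by
    field_simp
    norm_num
  rw [← hr]
  refine measure_exists_fin_le fun h => ?_
  rw [F.bellmanError_self]
  refine (pi_abs_avg_sub_integral_gt_le_of_mem_Icc (F.measurable_residualTaken f h) hn0
    (show (-2 : ℝ) < 1 by norm_num) (by positivity) (F.ae_residualTaken_mem hP _ f h)).trans ?_
  refine ENNReal.ofReal_le_ofReal (two_mul_exp_neg_le (by linarith) ?_)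
  have h2 : Real.log (12 * H ^ 2 * M * L / δ) =
      ε ^ 2 / (288 * H ^ 2) * (288 * H ^ 2 / ε ^ 2 * Real.log (12 * H ^ 2 * M * L / δ)) := by
    field_simp
  rw [h2]
  calc _ ≤ ε ^ 2 / (288 * H ^ 2) * n := by gcongr
    _ = _ := by
      field_simp
      norm_num

/-- Bernstein with `V = 4K` has exponent `n φ² / (16K) = n ε² / (2304 H² M K)`, so `nLearn` has a
factor two to spare. That `φ ≤ 1` keeps the deviation in the range where the bound applies. -/
theorem pi_learnError_gt_le [Nonempty A] (F : QClass X A N) {P : System X A}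
    (hP : P.RewardsBounded H)
    {M : ℕ} (hM : 0 < M) (hH : 0 < H) (hN : 0 < N) (hε : 0 < ε) (hε1 : ε < 1) (hζ : ε ≤ H * ζ)
    (hδ : 0 < δ) (hδ1 : δ < 1) (f : Fin N) (h : Fin H) :
    (Measure.pi fun _ : Fin (nLearn (Fintype.card A) N H M ζ ε δ) =>
      P.rollout (Rule.explore (F.greedy f) h) H)
      {E | ∃ g, phi H M ε < |F.learnError E g h - F.bellmanError P g (F.greedy f) h|} ≤
      ENNReal.ofReal (δ / (6 * (H * M * iterLog H M ζ ε))) := by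
  set K := Fintype.card A with hK
  set n := nLearn K N H M ζ ε δ with hn
  have hL := one_le_iterLog hM hε hζ
  set L := iterLog H M ζ ε with hLdef
  have hH' : (1 : ℝ) ≤ H := by exact_mod_cast hH
  have hM' : (1 : ℝ) ≤ M := by exact_mod_cast hM
  have hN' : (1 : ℝ) ≤ N := by exact_mod_cast hN
  have hK' : (1 : ℝ) ≤ K := by exact_mod_cast Fintype.card_pos (α := A)
  have hx : 1 < 12 * (N : ℝ) * H * M * L / δ := by
    rw [one_lt_div hδ]
    have : (1 : ℝ) ≤ N * H * M * L :=
      one_le_mul_of_one_le_of_one_le (one_le_mul_of_one_le_of_one_le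
        (one_le_mul_of_one_le_of_one_le hN' hH') hM') hL
    linarith
  have hn0 : 0 < n := Nat.ceil_pos.2 (mul_pos (by positivity) (Real.log_pos hx))
  have hnle : 4608 * H ^ 2 * M * K / ε ^ 2 * Real.log (12 * N * H * M * L / δ) ≤ n :=
    Nat.le_ceil _
  have hr : (N : ℝ) * (2 / (12 * N * H * M * L / δ)) = δ / (6 * (H * M * L)) := by
    field_simp
    norm_num
  have hs : √(M : ℝ) ^ 2 = M := Real.sq_sqrt (by positivity)
  have hs1 : (1 : ℝ) ≤ √M := Real.one_le_sqrt.2 hM'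
  have hφ0 : 0 < phi H M ε := by
    unfold phi
    positivity
  have hφ1 : phi H M ε ≤ 1 := by
    unfold phi
    rw [div_le_one (by positivity)]
    nlinarith [one_le_mul_of_one_le_of_one_le hH' hs1]
  have hφ2 : phi H M ε ^ 2 = ε ^ 2 / (144 * H ^ 2 * M) := by
    unfold phi
    rw [div_pow, mul_pow, mul_pow, hs]
    norm_num
  rw [← hr]
  refine measure_exists_fin_le fun g => ?_
  simp_rw [F.learnError_eq]
  rw [← F.integral_weightedResidual]
  refine (pi_abs_avg_sub_integral_gt_le_of_sq (F.measurable_weightedResidual g h) hn0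
    (V := 4 * K) (by positivity) hφ0.le (F.ae_abs_weightedResidual_le hP _ g h)
    (F.integral_weightedResidual_sq_le hP g _ h) (by nlinarith)).trans ?_
  refine ENNReal.ofReal_le_ofReal (two_mul_exp_neg_le (by linarith) ?_)
  have h2 : 2 * Real.log (12 * N * H * M * L / δ) = ε ^ 2 / (2304 * H ^ 2 * M * K) *
      (4608 * H ^ 2 * M * K / ε ^ 2 * Real.log (12 * N * H * M * L / δ)) := by
    field_simp
    ring
  calc _ ≤ 2 * Real.log (12 * N * H * M * L / δ) := by linarith [Real.log_pos hx]
    _ ≤ ε ^ 2 / (2304 * H ^ 2 * M * K) * n := by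
      rw [h2]
      gcongr
    _ = _ := by
      rw [hφ2]
      field_simp
      norm_num

/-- The largest number of episodes that OLIVE uses. -/
def callCost (K N H M : ℕ) (ζ ε δ : ℝ) : ℕ :=
  nEst N ε δ + maxIter H M ζ ε * (nEval H M ζ ε δ + nLearn K N H M ζ ε δ)

/-- The initial estimates take a third of the failure probability `δ'`. At most `2HM'L` iterations,
each with two bad events of probability at most `δ'/(6HM'L)`, take the rest. -/
theorem oliveCall_compl_goodOutcome_le [Nonempty A] {Mem : Type*} [MeasurableSpace Mem]
    {P : System X A} {F : QClass X A N} (hP : P.RewardsBounded H) (hH : 0 < H) (hε : 0 < ε)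
    (hε1 : ε < 1) (hζ : ε ≤ H * ζ) (hδ : 0 < δ) (hδ1 : δ < 1) (hv : ∃ f, F.IsValid P H f)
    (R : Resolver X A H N ε Mem) {i : ℕ} (hi : 1 ≤ i) {fail : Prop}
    (hT : ¬fail → ∀ l : List (Fin N × Fin H), F.Consistent P ε (phi H (2 ^ i) ε) l →
      l.length < maxIter H (2 ^ i) ζ ε) {c : ℕ}
    (hc : callCost (Fintype.card A) N H (2 ^ i) ζ ε (δ / (i * (i + 1))) ≤ c) (m : Mem) :
    oliveCall P F hH R ζ δ i m (goodOutcome Mem (F.nearOpt P H ε) fail c)ᶜ ≤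
      ENNReal.ofReal (δ / (i * (i + 1))) := by
  have hi' : (1 : ℝ) ≤ i := by exact_mod_cast hi
  set δ' := δ / (i * (i + 1)) with hδ'
  have hδ'0 : 0 < δ' := by positivity
  have hδ'1 : δ' < 1 := by
    rw [hδ', div_lt_one (by positivity)]
    nlinarith
  obtain ⟨fs, hfs, hopt⟩ := F.exists_isValid_optValue_eq hP hH hv
  have hN : 0 < N := fs.pos
  have hM : 0 < 2 ^ i := by positivity
  set M := 2 ^ i with hMdef
  have hL := one_le_iterLog hM hε hζ
  have hTle := maxIter_le hH hM hε hζ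
  set T := maxIter H M ζ ε with hTdef
  set η := ENNReal.ofReal (δ' / (6 * (H * M * iterLog H M ζ ε))) with hη
  have hgood := measurableSet_goodOutcome (Mem := Mem) (F.nearOpt P H ε) fail c
  have hmain : oliveCall P F hH R ζ δ i m (goodOutcome Mem (F.nearOpt P H ε) fail c)ᶜ ≤
      ENNReal.ofReal (δ' / 3) + T * (η + η) := by
    refine bind_apply_le_add hgood.compl (fun _ => prob_le_one)
      (pi_empValue_gt_le F P hH hN hε hδ'0 hδ'1 fun j => R.initRule i j) fun D hD => ?_
    have hD' : ∀ f, |F.empValue hH D f - F.predValue P f| ≤ ε / 8 :=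
      fun f => not_lt.1 fun hlt => hD ⟨f, hlt⟩
    exact oliveLoop_compl_goodOutcome_le R hP hH
      (fun f => pi_evalError_gt_le F hP hM hH hε hζ hδ'0 hδ'1 f)
      (fun f h => pi_learnError_gt_le F hP hM hH hN hε hε1 hζ hδ'0 hδ'1 f h) hD' hfs hopt hT T
      Finset.univ [] _ _ ⟨by simp, List.Pairwise.nil⟩ (by simp) (Finset.mem_univ _) (by simp) hc
  refine hmain.trans ?_
  rw [hη, ← ENNReal.ofReal_add (by positivity) (by positivity), ← ENNReal.ofReal_natCast,
    ← ENNReal.ofReal_mul (by positivity), ← ENNReal.ofReal_add (by positivity) (by positivity)]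
  refine ENNReal.ofReal_le_ofReal ?_
  have hH' : (1 : ℝ) ≤ H := by exact_mod_cast hH
  have hM' : (1 : ℝ) ≤ M := by exact_mod_cast hM
  calc δ' / 3 + (T : ℝ) * (δ' / (6 * (H * M * iterLog H M ζ ε)) +
        δ' / (6 * (H * M * iterLog H M ζ ε)))
      ≤ δ' / 3 + 2 * (H * M * iterLog H M ζ ε) * (δ' / (6 * (H * M * iterLog H M ζ ε)) +
        δ' / (6 * (H * M * iterLog H M ζ ε))) := by gcongr
    _ = δ' := by
      field_simp
      norm_num

end Estimation

end CDP

namespace CDP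

/-! ### The number of eliminations when the guess is large. -/

section Rank

/-- After taking logarithms, `log x ≤ x - 1` at `x = M' / (32M)` bounds the left side by a multiple
of `M (1 + log (M κ))` plus `M'/16`; the right side is `2 M' log 2`. -/
theorem potential_lt_two_pow {M M' : ℕ} {κ : ℝ} (hM : 0 < M) (hκ : 1 ≤ κ)
    (hM' : 32 * M * (1 + Real.log (M * κ)) ≤ M') :
    (2 * M' * (36 * M' * κ ^ 2) + M : ℝ) ^ M < 2 ^ (2 * M') := by
  have hMr : (1 : ℝ) ≤ M := by exact_mod_cast hM
  have hlogκ := Real.log_nonneg hκ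
  have hlogM := Real.log_nonneg hMr
  have hlog2 := Real.log_two_gt_d9
  have hlog2' := Real.log_two_lt_d9
  rw [Real.log_mul (by positivity) (by positivity)] at hM'
  have hM32 : 32 * (M : ℝ) ≤ M' := by nlinarith
  have hM'1 : (1 : ℝ) ≤ M' := by linarith
  have hle : (2 * M' * (36 * M' * κ ^ 2) + M : ℝ) ≤ 128 * M' ^ 2 * κ ^ 2 := by
    have h1 : (M : ℝ) ≤ M' ^ 2 * κ ^ 2 := by
      have h2 : (1 : ℝ) ≤ M' * κ ^ 2 := one_le_mul_of_one_le_of_one_le hM'1 (one_le_pow₀ hκ)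
      nlinarith
    nlinarith
  have hpos : (0 : ℝ) < 2 * M' * (36 * M' * κ ^ 2) + M := by positivity
  have hlog : Real.log (2 * M' * (36 * M' * κ ^ 2) + M) ≤
      7 * Real.log 2 + 2 * Real.log M' + 2 * Real.log κ := by
    refine (Real.log_le_log hpos hle).trans_eq ?_
    rw [Real.log_mul (by positivity) (by positivity), Real.log_mul (by positivity) (by positivity),
      Real.log_pow, Real.log_pow, show (128 : ℝ) = 2 ^ 7 by norm_num, Real.log_pow]
    norm_num
  have hlogM' : Real.log M' ≤ 5 * Real.log 2 + Real.log M + (M' / (32 * M) - 1) := by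
    have h1 : (M' : ℝ) = 2 ^ 5 * M * (M' / (32 * M)) := by
      field_simp
      norm_num
    have h2 := Real.log_le_sub_one_of_pos (show (0 : ℝ) < M' / (32 * M) by positivity)
    have h3 : Real.log M' = 5 * Real.log 2 + Real.log M + Real.log (M' / (32 * M)) := by
      conv_lhs => rw [h1]
      rw [Real.log_mul (by positivity) (by positivity),
        Real.log_mul (by positivity) (by positivity), Real.log_pow]
      norm_num
    linarith
  rw [← Real.log_lt_log_iff (by positivity) (by positivity), Real.log_pow, Real.log_pow]
  have h4 : (M : ℝ) * (M' / (32 * M)) = M' / 32 := by field_simp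
  calc (M : ℝ) * Real.log (2 * M' * (36 * M' * κ ^ 2) + M)
      ≤ M * (7 * Real.log 2 + 2 * (5 * Real.log 2 + Real.log M + (M' / (32 * M) - 1)) +
          2 * Real.log κ) := by
        gcongr
        linarith
    _ = M * (17 * Real.log 2 - 2) + 2 * (M * (Real.log M + Real.log κ)) +
          2 * (M * (M' / (32 * M))) := by ring
    _ < (2 * M' : ℕ) * Real.log 2 := by
        rw [h4]
        push_cast
        nlinarith

variable {X A : Type*} [MeasurableSpace X] [MeasurableSpace A] {N H : ℕ} {ζ ε : ℝ}

/-- The vectors live in the true dimension `M`, but the threshold uses the guess `M'`. The identity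
`(ε/(2H))² = 9M' (2φ)²` gives `r = 9M'` in the determinant bound, and the norm bound gives `(ab/η)²
≤ 36M' (Hζ/ε)²`. -/
theorem QClass.BellmanFactorization.length_filter_lt {F : QClass X A N} {P : System X A}
    {M M' : ℕ} (hF : F.BellmanFactorization P H M ζ) (hM : 0 < M) (hH : 0 < H) (hε : 0 < ε)
    (hζ : ε ≤ H * ζ) (hM' : 32 * M * (1 + Real.log (M * (H * ζ / ε))) ≤ M')
    {l : List (Fin N × Fin H)} (hl : F.Consistent P ε (phi H M' ε) l) (h : Fin H) :
    (l.filter fun p => p.2 = h).length < 2 * M' := by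
  by_contra! hge
  have hH' : (1 : ℝ) ≤ H := by exact_mod_cast hH
  have hκ : 1 ≤ H * ζ / ε := (one_le_div hε).2 hζ
  have hζ0 : 0 ≤ ζ := by
    by_contra! hneg
    nlinarith
  have hMr : (1 : ℝ) ≤ M := by exact_mod_cast hM
  have hM'1 : (1 : ℝ) ≤ M' := by
    have := Real.log_nonneg (one_le_mul_of_one_le_of_one_le hMr hκ)
    nlinarith
  obtain ⟨ν, ξ, hνξ⟩ := hF
  have hin : ∀ f f', F.bellmanError P f (F.greedy f') h =
      (ν h f').ofLp ⬝ᵥ (ξ h f).ofLp := by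
    intro f f'
    rw [(hνξ f f' h).1, EuclideanSpace.inner_eq_star_dotProduct, star_trivial, dotProduct_comm]
  have hnorm : ∀ v : EuclideanSpace ℝ (Fin M), v.ofLp ⬝ᵥ v.ofLp = ‖v‖ ^ 2 := by
    intro v
    rw [← real_inner_self_eq_norm_sq, EuclideanSpace.inner_eq_star_dotProduct, star_trivial]
  -- The determinant bound is limited to length `9 * M'`, so a list that is too long is first cut to
  -- exactly `2 * M'` elements.
  set l' := (l.filter fun p => p.2 = h).take (2 * M') with hl'
  have hsub : l'.Sublist l := (List.take_sublist _ _).trans List.filter_sublist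
  have hlen : l'.length = 2 * M' := by
    rw [hl', List.length_take]
    exact min_eq_left hge
  have hmem : ∀ p ∈ l', p.2 = h := fun p hp => by
    simpa using (List.mem_filter.1 ((List.take_sublist _ _).subset hp)).2
  have hbig : ∀ p ∈ l', ε / (2 * H) ≤ F.bellmanError P p.1 (F.greedy p.1) h := fun p hp => by
    have := hl.1 p (hsub.subset hp)
    rwa [hmem p hp] at this
  obtain ⟨p₀, hp₀⟩ : ∃ p₀, p₀ ∈ l' := by
    refine List.exists_mem_of_length_pos ?_
    rw [hlen]
    have : 0 < M' := by exact_mod_cast (show (0 : ℝ) < M' by linarith)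
    omega
  have : Nonempty (Fin N) := ⟨p₀.1⟩
  -- The factorization bounds the product of norms for every pair of functions, so even the two
  -- separate maxima have product at most `ζ`.
  obtain ⟨fa, hfa⟩ := Finite.exists_max fun f => ‖ν h f‖
  obtain ⟨fb, hfb⟩ := Finite.exists_max fun f => ‖ξ h f‖
  have hb : 0 < ‖ξ h fb‖ := by
    refine lt_of_lt_of_le ?_ (hfb p₀.1)
    rw [norm_pos_iff]
    intro h0
    have h1 := hbig p₀ hp₀
    rw [hin, h0] at h1
    simp only [WithLp.ofLp_zero, dotProduct_zero] at h1
    have : 0 < ε / (2 * H) := by positivity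
    linarith
  have hM's : √(M' : ℝ) ^ 2 = M' := Real.sq_sqrt (by positivity)
  have hη : 0 < 2 * phi H M' ε := by
    unfold phi
    positivity
  have hη2 : (2 * phi H M' ε) ^ 2 = ε ^ 2 / (36 * H ^ 2 * M') := by
    unfold phi
    rw [mul_pow, div_pow, mul_pow, mul_pow, hM's]
    field_simp
    norm_num
  have key := two_pow_length_le_of_pairwise (a := ‖ν h fa‖) (b := ‖ξ h fb‖)
    (η := 2 * phi H M' ε) (r := 9 * M') hb hη
    (l'.map fun p => ((ν h p.1).ofLp, (ξ h p.1).ofLp))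
    (by
      simp only [List.mem_map, forall_exists_index, and_imp, forall_apply_eq_imp_iff₂]
      intro p _
      rw [hnorm]
      exact pow_le_pow_left₀ (norm_nonneg _) (hfa p.1) 2)
    (by
      simp only [List.mem_map, forall_exists_index, and_imp, forall_apply_eq_imp_iff₂]
      intro p _
      rw [hnorm]
      exact pow_le_pow_left₀ (norm_nonneg _) (hfb p.1) 2)
    (by
      simp only [List.mem_map, forall_exists_index, and_imp, forall_apply_eq_imp_iff₂]
      intro p hp
      rw [← hin, hη2]
      have h1 : 9 * (M' : ℝ) * (ε ^ 2 / (36 * H ^ 2 * M')) = (ε / (2 * H)) ^ 2 := by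
        field_simp
        norm_num
      rw [h1]
      exact pow_le_pow_left₀ (by positivity) (hbig p hp) 2)
    (by
      rw [List.pairwise_map]
      refine (hl.2.sublist hsub).imp_of_mem fun {p q} hp hq hpq => ?_
      have h1 := hpq ((hmem q hq).trans (hmem p hp).symm)
      rw [hmem p hp, hin] at h1
      rw [← sq_abs]
      exact pow_le_pow_left₀ (abs_nonneg _) h1 2)
    (by
      rw [List.length_map, hlen]
      push_cast
      linarith)
  rw [List.length_map, hlen] at key
  have hab : (‖ν h fa‖ * ‖ξ h fb‖ / (2 * phi H M' ε)) ^ 2 ≤ 36 * M' * (H * ζ / ε) ^ 2 := by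
    rw [div_pow, hη2, div_pow, mul_pow (H : ℝ) ζ]
    have h1 : (‖ν h fa‖ * ‖ξ h fb‖) ^ 2 ≤ ζ ^ 2 :=
      pow_le_pow_left₀ (by positivity) (hνξ fb fa h).2 2
    calc _ ≤ ζ ^ 2 / (ε ^ 2 / (36 * H ^ 2 * M')) := by gcongr
      _ = _ := by field_simp
  refine absurd (potential_lt_two_pow hM hκ hM') (not_lt.2 (key.trans ?_))
  push_cast
  gcongr

/-- Consistency relates only eliminations at the same level, so the count is made level by level. -/
theorem QClass.BellmanFactorization.length_lt_maxIter {F : QClass X A N} {P : System X A}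
    {M M' : ℕ} (hF : F.BellmanFactorization P H M ζ) (hM : 0 < M) (hH : 0 < H) (hε : 0 < ε)
    (hζ : ε ≤ H * ζ) (hM' : 32 * M * (1 + Real.log (M * (H * ζ / ε))) ≤ M')
    {l : List (Fin N × Fin H)} (hl : F.Consistent P ε (phi H M' ε) l) :
    l.length < maxIter H M' ζ ε := by
  have hκ : 1 ≤ H * ζ / ε := (one_le_div hε).2 hζ
  have hMr : (1 : ℝ) ≤ M := by exact_mod_cast hM
  have hM'4 : 4 ≤ M' := by
    have := Real.log_nonneg (one_le_mul_of_one_le_of_one_le hMr hκ)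
    have h4 : (4 : ℝ) ≤ M' := by nlinarith
    exact_mod_cast h4
  refine lt_of_lt_of_le ?_ (two_mul_le_maxIter hH hM'4 hε hζ)
  have hsum : l.length = ∑ h : Fin H, (l.filter fun p => p.2 = h).length := by
    clear hl
    induction l with
    | nil => simp
    | cons p l ih =>
      have h1 : ∀ h : Fin H, ((p :: l).filter fun p => p.2 = h).length =
          (l.filter fun p => p.2 = h).length + if p.2 = h then 1 else 0 := by
        intro h
        by_cases hp : p.2 = h <;> simp [hp]
      simp_rw [h1]
      rw [Finset.sum_add_distrib, ← ih]
      simp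
  have : Nonempty (Fin H) := ⟨⟨0, hH⟩⟩
  rw [hsum]
  calc _ < ∑ _h : Fin H, 2 * M' :=
        Finset.sum_lt_sum_of_nonempty Finset.univ_nonempty fun h _ =>
          hF.length_filter_lt hM hH hε hζ hM' hl h
    _ = 2 * (H * M') := by
        simp
        ring

end Rank

end CDP

namespace CDP

/-! ### The total number of episodes. -/

section Cost

variable {K N H M i : ℕ} {ζ ε δ : ℝ}

/-- The quantity of which all logarithmic factors are logarithms. -/
def complexity (K H M : ℕ) (ζ ε : ℝ) : ℝ := M * H * K * max 1 ζ / ε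

theorem le_complexity (hK : 0 < K) (hH : 0 < H) (hM : 0 < M) (hε : 0 < ε) (hε1 : ε < 1) :
    1 ≤ complexity K H M ζ ε ∧ (M : ℝ) ≤ complexity K H M ζ ε ∧
      (H : ℝ) ≤ complexity K H M ζ ε ∧ (H : ℝ) / ε ≤ complexity K H M ζ ε ∧
      M * (H * ζ / ε) ≤ complexity K H M ζ ε := by
  have hK' : (1 : ℝ) ≤ K := by exact_mod_cast hK
  have hH' : (1 : ℝ) ≤ H := by exact_mod_cast hH
  have hM' : (1 : ℝ) ≤ M := by exact_mod_cast hM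
  have hz : (1 : ℝ) ≤ max 1 ζ := le_max_left _ _
  have hinv : 1 ≤ 1 / ε := by
    rw [one_le_div hε]
    exact hε1.le
  have hKz : (1 : ℝ) ≤ K * max 1 ζ := one_le_mul_of_one_le_of_one_le hK' hz
  have heq : complexity K H M ζ ε = M * (H * (1 / ε * (K * max 1 ζ))) := by
    unfold complexity
    ring
  have h1 : 1 ≤ 1 / ε * (K * max 1 ζ) := one_le_mul_of_one_le_of_one_le hinv hKz
  have h2 : 1 ≤ H * (1 / ε * (K * max 1 ζ)) := one_le_mul_of_one_le_of_one_le hH' h1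
  have h3 : (H : ℝ) / ε ≤ complexity K H M ζ ε := by
    have h4 : (H : ℝ) / ε * 1 ≤ H / ε * (M * (K * max 1 ζ)) :=
      mul_le_mul_of_nonneg_left (one_le_mul_of_one_le_of_one_le hM' hKz) (by positivity)
    calc (H : ℝ) / ε = H / ε * 1 := (mul_one _).symm
      _ ≤ _ := h4
      _ = _ := by rw [heq]; ring
  refine ⟨?_, ?_, ?_, h3, ?_⟩
  · rw [heq]
    exact one_le_mul_of_one_le_of_one_le hM' h2
  · rw [heq]
    nlinarith
  · refine le_trans ?_ h3
    rw [le_div_iff₀ hε]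
    nlinarith
  · have h5 : ζ ≤ K * max 1 ζ := by nlinarith [le_max_right 1 ζ]
    calc (M : ℝ) * (H * ζ / ε) = M * H / ε * ζ := by ring
      _ ≤ M * H / ε * (K * max 1 ζ) := mul_le_mul_of_nonneg_left h5 (by positivity)
      _ = _ := by rw [heq]; ring

/-- Since `19 log 2 < 14`, one unit of the factor `15` is left for `log z`; the sum is then at most
the product because both factors are at least one. -/
theorem log_le_of_le_complexity_pow {Q y z : ℝ} (hQ : 1 ≤ Q) (hy : 0 < y) (hz : 0 < z)
    (h : y ≤ 2 ^ 19 * Q ^ 8 * z) :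
    Real.log y ≤ 15 * (1 + Real.log Q) * max 1 (Real.log z) := by
  have hlog := Real.log_le_log hy h
  rw [Real.log_mul (by positivity) (by positivity), Real.log_mul (by positivity) (by positivity),
    Real.log_pow, Real.log_pow] at hlog
  have h1 := Real.log_nonneg hQ
  have h2 := le_max_left 1 (Real.log z)
  have h3 := le_max_right 1 (Real.log z)
  have h4 := Real.log_two_lt_d9
  push_cast at hlog
  nlinarith [mul_nonneg h1 (sub_nonneg.2 h2)]

theorem natCeil_le_add_one {x y : ℝ} (hxy : x ≤ y) (hy : 0 ≤ y) : (⌈x⌉₊ : ℝ) ≤ y + 1 := by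
  refine le_trans ?_ (Nat.ceil_lt_add_one hy).le
  exact_mod_cast Nat.ceil_mono hxy

theorem index_le {Q Λ : ℝ} (hQ : 1 ≤ Q) (hΛ : Λ = 1 + Real.log Q)
    (hi : (2 : ℝ) ^ i ≤ 64 * Q * Λ) : (i : ℝ) ≤ 6 * Λ := by
  have hΛQ : Λ ≤ Q := by
    have := Real.log_le_sub_one_of_pos (show 0 < Q by linarith)
    linarith
  have h1 : (2 : ℝ) ^ i ≤ 2 ^ 6 * Q ^ 2 := by
    refine hi.trans ?_
    nlinarith
  have h2 := Real.log_le_log (by positivity) h1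
  rw [Real.log_mul (by positivity) (by positivity), Real.log_pow, Real.log_pow, Real.log_pow] at h2
  push_cast at h2
  have h3 := Real.log_nonneg hQ
  have h4 := Real.log_two_gt_d9
  have h5 : ((i : ℝ) - 6) * Real.log 2 ≤ 2 * Real.log Q := by linarith
  by_contra! h6
  rw [hΛ] at h6
  nlinarith

theorem iterLog_le {κ Q Λ : ℝ} (hκdef : κ = H * ζ / ε) (hκ : 1 ≤ κ) (hκQ : κ ≤ Q)
    (hΛ : Λ = 1 + Real.log Q) (hM : 0 < M) (hMQ : (M : ℝ) ≤ 64 * Q ^ 2) :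
    iterLog H M ζ ε ≤ 5 * Λ := by
  have hQ1 : 1 ≤ Q := hκ.trans hκQ
  have hM' : (0 : ℝ) < M := by exact_mod_cast hM
  have hsqrt : √(M : ℝ) ≤ 8 * Q := by
    refine Real.sqrt_le_iff.2 ⟨by linarith, hMQ.trans_eq ?_⟩
    ring
  have heq : 6 * H * √(M : ℝ) * ζ / ε = 6 * κ * √(M : ℝ) := by
    rw [hκdef]
    ring
  have h1 : 6 * κ * √(M : ℝ) ≤ 2 ^ 6 * Q ^ 2 := by
    calc 6 * κ * √(M : ℝ) ≤ 6 * Q * (8 * Q) := by gcongr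
      _ ≤ _ := by nlinarith
  have h2 := Real.log_le_log (by positivity) h1
  rw [← heq, Real.log_mul (x := 2 ^ 6) (by positivity) (by positivity), Real.log_pow,
    Real.log_pow] at h2
  push_cast at h2
  have h3 := Real.log_two_lt_d9
  have h4 := Real.log_nonneg hQ1
  change iterLog H M ζ ε ≤ _ at h2
  linarith

theorem callCost_le_of_log_le {G Λ M₀ : ℝ} (hK : 0 < K) (hH : 0 < H) (hM : 0 < M) (hε : 0 < ε)
    (hε1 : ε < 1) (hζ : ε ≤ H * ζ) (hG1 : 1 ≤ G) (hM₀ : 1 ≤ M₀) (hΛ1 : 1 ≤ Λ)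
    (hMM₀ : (M : ℝ) ≤ 64 * M₀ * Λ) (hL : iterLog H M ζ ε ≤ 5 * Λ)
    (hest : Real.log (6 * N / δ) ≤ G)
    (heval : Real.log (12 * H ^ 2 * M * iterLog H M ζ ε / δ) ≤ G)
    (hlearn : Real.log (12 * N * H * M * iterLog H M ζ ε / δ) ≤ G) :
    (callCost K N H M ζ ε δ : ℝ) ≤
      200622113 * (M₀ ^ 2 * H ^ 3 * K / ε ^ 2) * G * Λ ^ 3 := by
  have hK' : (1 : ℝ) ≤ K := by exact_mod_cast hK
  have hH' : (1 : ℝ) ≤ H := by exact_mod_cast hH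
  have hM' : (1 : ℝ) ≤ M := by exact_mod_cast hM
  have hεi : 1 ≤ 1 / ε ^ 2 := by
    rw [one_le_div (by positivity)]
    exact pow_le_one₀ hε.le hε1.le
  have hest' : (nEst N ε δ : ℝ) ≤ 33 * (1 / ε ^ 2) * G := by
    refine (natCeil_le_add_one (mul_le_mul_of_nonneg_left hest (by positivity))
      (by positivity)).trans ?_
    have h2 : 1 ≤ 1 / ε ^ 2 * G := one_le_mul_of_one_le_of_one_le hεi hG1
    calc 32 / ε ^ 2 * G + 1 ≤ 32 / ε ^ 2 * G + 1 / ε ^ 2 * G := by linarith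
      _ = _ := by ring
  set U := (H : ℝ) ^ 2 * M * K * (1 / ε ^ 2) * G with hU
  have hU1 : 1 ≤ U :=
    one_le_mul_of_one_le_of_one_le (one_le_mul_of_one_le_of_one_le
      (one_le_mul_of_one_le_of_one_le (one_le_mul_of_one_le_of_one_le (one_le_pow₀ hH') hM') hK')
      hεi) hG1
  have heval' : (nEval H M ζ ε δ : ℝ) ≤ 289 * U := by
    refine (natCeil_le_add_one (mul_le_mul_of_nonneg_left heval (by positivity))
      (by positivity)).trans ?_
    have h2 : (1 : ℝ) ≤ M * K := one_le_mul_of_one_le_of_one_le hM' hK'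
    have h3 : 288 * (H : ℝ) ^ 2 / ε ^ 2 * G * 1 ≤ 288 * H ^ 2 / ε ^ 2 * G * (M * K) :=
      mul_le_mul_of_nonneg_left h2 (by positivity)
    calc 288 * (H : ℝ) ^ 2 / ε ^ 2 * G + 1
        ≤ 288 * H ^ 2 / ε ^ 2 * G * (M * K) + U := by linarith
      _ = _ := by rw [hU]; ring
  have hlearn' : (nLearn K N H M ζ ε δ : ℝ) ≤ 4609 * U := by
    refine (natCeil_le_add_one (mul_le_mul_of_nonneg_left hlearn (by positivity))
      (by positivity)).trans ?_
    calc 4608 * (H : ℝ) ^ 2 * M * K / ε ^ 2 * G + 1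
        ≤ 4608 * H ^ 2 * M * K / ε ^ 2 * G + U := by linarith
      _ = _ := by rw [hU]; ring
  have hT : (maxIter H M ζ ε : ℝ) ≤ 10 * (H * M * Λ) := by
    refine (maxIter_le hH hM hε hζ).trans ?_
    calc 2 * (H * M * iterLog H M ζ ε) ≤ 2 * (H * M * (5 * Λ)) := by gcongr
      _ = _ := by ring
  have hbase : (1 : ℝ) ≤ M₀ ^ 2 * H ^ 3 * K * Λ ^ 3 :=
    one_le_mul_of_one_le_of_one_le (one_le_mul_of_one_le_of_one_le
      (one_le_mul_of_one_le_of_one_le (one_le_pow₀ hM₀) (one_le_pow₀ hH')) hK') (one_le_pow₀ hΛ1)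
  unfold callCost
  push_cast
  -- The final constant is `33 + 10 * (289 + 4609) * 64 ^ 2`.
  calc (nEst N ε δ : ℝ) + maxIter H M ζ ε * (nEval H M ζ ε δ + nLearn K N H M ζ ε δ)
      ≤ 33 * (1 / ε ^ 2) * G + 10 * (H * M * Λ) * (289 * U + 4609 * U) := by gcongr
    _ = 33 * (1 / ε ^ 2) * G * 1 + 48980 * (H ^ 3 * K * (1 / ε ^ 2) * Λ * G) * M ^ 2 := by
      rw [hU]
      ring
    _ ≤ 33 * (1 / ε ^ 2) * G * (M₀ ^ 2 * H ^ 3 * K * Λ ^ 3) +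
          48980 * (H ^ 3 * K * (1 / ε ^ 2) * Λ * G) * (64 * M₀ * Λ) ^ 2 := by gcongr
    _ = _ := by ring

theorem callCost_le (hK : 0 < K) (hN : 0 < N) (hH : 0 < H) (hM : 0 < M) (hi : 1 ≤ i)
    (hε : 0 < ε) (hε1 : ε < 1) (hδ : 0 < δ) (hζ : ε ≤ H * ζ) {Λ : ℝ}
    (hΛ : Λ = 1 + Real.log (complexity K H M ζ ε)) (hiM : (2 : ℝ) ^ i ≤ 64 * M * Λ) :
    (callCost K N H (2 ^ i) ζ ε (δ / (i * (i + 1))) : ℝ) ≤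
      3100000000 * (M ^ 2 * H ^ 3 * K / ε ^ 2) * max 1 (Real.log (N * ζ / δ)) * Λ ^ 4 := by
  obtain ⟨hQ1, hQM, hQH, hQHε, hQκ⟩ := le_complexity (ζ := ζ) hK hH hM hε hε1
  set Q := complexity K H M ζ ε
  have hN' : (1 : ℝ) ≤ N := by exact_mod_cast hN
  have hH' : (1 : ℝ) ≤ H := by exact_mod_cast hH
  have hM' : (1 : ℝ) ≤ M := by exact_mod_cast hM
  have hi' : (1 : ℝ) ≤ i := by exact_mod_cast hi
  have hκ : 1 ≤ H * ζ / ε := (one_le_div hε).2 hζ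
  have hζ0 : 0 < ζ := by
    by_contra! hneg
    nlinarith
  have hΛ1 : 1 ≤ Λ := by linarith [Real.log_nonneg hQ1]
  have hΛQ : Λ ≤ Q := by
    have := Real.log_le_sub_one_of_pos (show 0 < Q by linarith)
    linarith
  have hM'r : ((2 ^ i : ℕ) : ℝ) ≤ 64 * M * Λ := by
    push_cast
    exact hiM
  have hM'pos : 0 < 2 ^ i := by positivity
  have hiΛ : (i : ℝ) ≤ 6 * Λ := index_le hQ1 hΛ (hiM.trans (by gcongr))
  generalize 2 ^ i = M' at hM'r hM'pos ⊢
  have hM'Q : (M' : ℝ) ≤ 64 * Q ^ 2 :=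
    calc (M' : ℝ) ≤ 64 * M * Λ := hM'r
      _ ≤ 64 * Q * Q := by gcongr
      _ = _ := by ring
  have hiQ : (i : ℝ) * (i + 1) ≤ 72 * Q ^ 2 :=
    calc (i : ℝ) * (i + 1) ≤ (6 * Q) * (6 * Q + 6 * Q) := by
          gcongr <;> linarith
      _ = _ := by ring
  have hL1 := one_le_iterLog hM'pos hε hζ
  have hLΛ : iterLog H M' ζ ε ≤ 5 * Λ :=
    iterLog_le rfl hκ (le_trans (le_mul_of_one_le_left (by linarith) hM') hQκ) hΛ hM'pos hM'Q
  have hLQ : iterLog H M' ζ ε ≤ 5 * Q := by linarith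
  set z := N * ζ / δ with hz
  have hz0 : 0 < z := by positivity
  have hNδ' : N / (δ / (i * (i + 1))) ≤ 72 * Q ^ 2 * (Q * z) := by
    -- As `ζ` may be below one, `N / δ` need not be at most `z`; `ε ≤ H * ζ` makes one factor `Q`
    -- enough compensation.
    have h1 : 1 ≤ Q * ζ := by
      calc (1 : ℝ) ≤ H / ε * ζ := by rwa [div_mul_eq_mul_div]
        _ ≤ Q * ζ := by gcongr
    have h2 : (N : ℝ) / δ ≤ Q * z :=
      calc (N : ℝ) / δ = N / δ * 1 := (mul_one _).symm
        _ ≤ N / δ * (Q * ζ) := by gcongr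
        _ = Q * z := by rw [hz]; ring
    calc N / (δ / (i * (i + 1))) = i * (i + 1) * (N / δ) := by field_simp
      _ ≤ _ := by gcongr
  have hδ'0 : 0 < δ / (i * (i + 1)) := by positivity
  generalize δ / (i * (i + 1)) = δ' at hNδ' hδ'0 ⊢
  -- The powers fit the worst of the three arguments, `276480 * Q ^ 8 * z` in `heval`.
  have hlog : ∀ y, 0 < y → y ≤ 2 ^ 19 * Q ^ 8 * z →
      Real.log y ≤ 15 * Λ * max 1 (Real.log z) := fun y hy hyz => by
    have := log_le_of_le_complexity_pow hQ1 hy hz0 hyz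
    rwa [← hΛ] at this
  have hM'1 : (0 : ℝ) < M' := by exact_mod_cast hM'pos
  have hcommon : N / δ' * H * M' * iterLog H M' ζ ε ≤ 23040 * Q ^ 7 * z := by
    calc N / δ' * H * M' * iterLog H M' ζ ε
        ≤ 72 * Q ^ 2 * (Q * z) * Q * (64 * Q ^ 2) * (5 * Q) := by gcongr
      _ = _ := by ring
  have hest : 6 * N / δ' ≤ 2 ^ 19 * Q ^ 8 * z := by
    calc 6 * N / δ' = 6 * (N / δ') := by ring
      _ ≤ 6 * (72 * Q ^ 2 * (Q * z)) := by gcongr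
      _ = 432 * Q ^ 3 * z := by ring
      _ ≤ 2 ^ 19 * Q ^ 8 * z := by gcongr <;> norm_num
  have heval : 12 * H ^ 2 * M' * iterLog H M' ζ ε / δ' ≤ 2 ^ 19 * Q ^ 8 * z := by
    calc 12 * H ^ 2 * M' * iterLog H M' ζ ε / δ'
        = 12 * H * (1 / δ' * H * M' * iterLog H M' ζ ε) := by ring
      _ ≤ 12 * Q * (N / δ' * H * M' * iterLog H M' ζ ε) := by gcongr
      _ ≤ 12 * Q * (23040 * Q ^ 7 * z) := by gcongr
      _ = 276480 * Q ^ 8 * z := by ring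
      _ ≤ 2 ^ 19 * Q ^ 8 * z := by gcongr; norm_num
  have hlearn : 12 * N * H * M' * iterLog H M' ζ ε / δ' ≤ 2 ^ 19 * Q ^ 8 * z := by
    calc 12 * N * H * M' * iterLog H M' ζ ε / δ'
        = 12 * (N / δ' * H * M' * iterLog H M' ζ ε) := by ring
      _ ≤ 12 * (23040 * Q ^ 7 * z) := by gcongr
      _ = 276480 * Q ^ 7 * z := by ring
      _ ≤ 2 ^ 19 * Q ^ 8 * z := by gcongr <;> norm_num
  have hD1 : 1 ≤ max 1 (Real.log z) := le_max_left _ _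
  have hΛD : 1 ≤ Λ * max 1 (Real.log z) := one_le_mul_of_one_le_of_one_le hΛ1 hD1
  refine (callCost_le_of_log_le hK hH hM'pos hε hε1 hζ (by linarith) hM' hΛ1 hM'r hLΛ
    (hlog _ (by positivity) hest) (hlog _ (by positivity) heval)
    (hlog _ (by positivity) hlearn)).trans ?_
  calc _ = 3009331695 * ((M ^ 2 * H ^ 3 * K / ε ^ 2) * max 1 (Real.log z) * Λ ^ 4) := by ring
    _ ≤ 3100000000 * ((M ^ 2 * H ^ 3 * K / ε ^ 2) * max 1 (Real.log z) * Λ ^ 4) := by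
      gcongr
      norm_num
    _ = _ := by ring

theorem sum_failure_le (hδ : 0 < δ) (n : ℕ) :
    ∑ j ∈ Finset.Ico 1 (n + 1), ENNReal.ofReal (δ / (j * (j + 1))) ≤ ENNReal.ofReal δ := by
  rw [← ENNReal.ofReal_sum_of_nonneg fun j _ => by positivity]
  refine ENNReal.ofReal_le_ofReal ?_
  have h : ∀ n : ℕ, ∑ j ∈ Finset.Ico 1 (n + 1), δ / ((j : ℝ) * (j + 1)) =
      δ * (1 - 1 / (n + 1)) := by
    intro n
    induction n with
    | zero => simp
    | succ n ih =>
      rw [Finset.sum_Ico_succ_top (by omega), ih]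
      push_cast
      field_simp
      ring
  rw [h n]
  have : (0 : ℝ) ≤ 1 / (n + 1) := by positivity
  nlinarith

end Cost

end CDP

end

/-! ### The guarantee for GuessM. -/

theorem theorem2 :
    ∃ (C : ℝ) (p : ℕ), 0 < C ∧
      ∀ (X A Mem : Type*) [MeasurableSpace X] [MeasurableSpace A] [DiscreteMeasurableSpace A]
        [Fintype A] [Nonempty A] [MeasurableSpace Mem]
        (H M N : ℕ) (hH : 0 < H) (_ : 0 < M) (ε δ ζ : ℝ)
        (P : CDP.System X A) (F : CDP.QClass X A N) (R : CDP.Resolver X A H N ε Mem) (m₀ : Mem),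
        0 < ε → ε < 1 → 0 < δ → δ < 1 → ε ≤ H * ζ →
        P.RewardsBounded H →
        (∃ f, F.IsValid P H f) →
        F.BellmanFactorization P H M ζ →
        ENNReal.ofReal (1 - δ) ≤
          CDP.guessProb P F hH R ζ δ m₀
            {o | F.optValue P H - ε ≤ P.value H (F.greedy o.1) ∧
              (o.2 : ℝ) ≤ C * (M ^ 2 * H ^ 3 * Fintype.card A / ε ^ 2) *
                max 1 (Real.log (N * ζ / δ)) *
                (1 + Real.log (M * H * Fintype.card A * max 1 ζ / ε)) ^ p} := by
  -- At most `6Λ` calls are made, and each costs at most `3100000000` times the leading terms times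
  -- `Λ ^ 4`.
  refine ⟨6 * 3100000000, 5, by norm_num, ?_⟩
  intro X A Mem _ _ _ _ _ _ H M N hH hM ε δ ζ P F R m₀ hε hε1 hδ hδ1 hζ hP hv hF
  have hK : 0 < Fintype.card A := Fintype.card_pos
  have hN : 0 < N := hv.choose.pos
  obtain ⟨hQ1, hQM, -, -, hQκ⟩ := CDP.le_complexity (ζ := ζ) hK hH hM hε hε1
  have hcomp : CDP.complexity (Fintype.card A) H M ζ ε =
    M * H * Fintype.card A * max 1 ζ / ε := rfl
  rw [← hcomp]
  set Q := CDP.complexity (Fintype.card A) H M ζ ε with hQ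
  set Λ := 1 + Real.log Q with hΛ
  have hM' : (1 : ℝ) ≤ M := by exact_mod_cast hM
  have hΛ1 : 1 ≤ Λ := by linarith [Real.log_nonneg hQ1]
  set b : ℝ := 3100000000 * (M ^ 2 * H ^ 3 * Fintype.card A / ε ^ 2) *
    max 1 (Real.log (N * ζ / δ)) * Λ ^ 4 with hb
  have hb0 : 0 ≤ b := by positivity
  -- Call `n + 1` is the first whose guess exceeds `32MΛ`, so it cannot run out of iterations; all
  -- guesses up to it are at most `64MΛ`.
  obtain ⟨n, hn1, hn2⟩ := exists_nat_pow_near (show 1 ≤ 32 * M * Λ by nlinarith)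
    (show (1 : ℝ) < 2 by norm_num)
  set G : Set (Fin N × ℕ) := _
  change _ ≤ CDP.guessProb P F hH R ζ δ m₀ G
  have hle : ∀ i ≤ n + 1, (2 : ℝ) ^ i ≤ 64 * M * Λ := fun i hi =>
    calc (2 : ℝ) ^ i ≤ 2 ^ (n + 1) := pow_le_pow_right₀ (by norm_num) hi
      _ = 2 * 2 ^ n := by ring
      _ ≤ 2 * (32 * M * Λ) := by gcongr
      _ = _ := by ring
  have hcall : ∀ i, 1 ≤ i → i ≤ n + 1 → ∀ m, CDP.oliveCall P F hH R ζ δ i m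
      (CDP.goodOutcome Mem (F.nearOpt P H ε) (i < n + 1) ⌊b⌋₊)ᶜ ≤
        ENNReal.ofReal (δ / (i * (i + 1))) := by
    intro i hi hin m
    refine CDP.oliveCall_compl_goodOutcome_le hP hH hε hε1 hζ hδ hδ1 hv R hi ?_
      (Nat.le_floor (CDP.callCost_le hK hN hH hM hi hε hε1 hδ hζ hΛ (hle i hin))) m
    intro hlast l hl
    refine hF.length_lt_maxIter hM hH hε hζ ?_ hl
    have hi' : i = n + 1 := by omega
    have hκ : 1 ≤ H * ζ / ε := (one_le_div hε).2 hζ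
    have hlog : Real.log (M * (H * ζ / ε)) ≤ Real.log Q :=
      Real.log_le_log (by positivity) hQκ
    rw [hi']
    push_cast
    refine le_trans ?_ hn2.le
    gcongr
    linarith
  have hrun := CDP.guessRun_compl_le hH R (B := (n + 1) * ⌊b⌋₊) hcall (n + 1) 1 m₀ 0 le_rfl
    (by omega) (by omega) (by omega)
  have hsub : CDP.goodOutcome Mem (F.nearOpt P H ε) False ((n + 1) * ⌊b⌋₊) ⊆ Sum.inl '' G := by
    rintro (⟨f, e⟩ | ⟨m, e⟩) ho
    · obtain ⟨h1, h2⟩ := CDP.inl_mem_goodOutcome.1 ho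
      refine ⟨(f, e), ⟨h1, ?_⟩, rfl⟩
      have hidx : ((n + 1 : ℕ) : ℝ) ≤ 6 * Λ :=
        CDP.index_le hQ1 hΛ ((hle _ le_rfl).trans (by gcongr))
      calc (e : ℝ) ≤ ((n + 1 : ℕ) : ℝ) * (⌊b⌋₊ : ℝ) := by exact_mod_cast h2
        _ ≤ 6 * Λ * b := by
          gcongr
          exact Nat.floor_le hb0
        _ = _ := by
          rw [hb]
          ring
    · exact (CDP.inr_mem_goodOutcome.1 ho).1.elim
  -- The supremum over the number of calls is bounded below by its term for `n + 1` calls.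
  refine le_trans ?_ (le_iSup _ (n + 1))
  refine le_trans ?_ (measure_mono hsub)
  have hgood := CDP.measurableSet_goodOutcome (Mem := Mem) (F.nearOpt P H ε) False
    ((n + 1) * ⌊b⌋₊)
  have hcompl := prob_compl_eq_one_sub (μ := CDP.guessRun P F hH R ζ δ (n + 1) 1 m₀ 0) hgood.compl
  rw [compl_compl] at hcompl
  rw [hcompl, ENNReal.ofReal_sub _ hδ.le, ENNReal.ofReal_one]
  exact tsub_le_tsub_left (hrun.trans (CDP.sum_failure_le hδ _)) _
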